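/- Let $G$ be a discrete group, let $M$ be a II$_1$ factor (an infinite-dimensional factor with a faithful normal tracial state) with normalized trace $\tau$, let $\alpha : G\to \mathrm{Aut}(M)$ be an action of $G$ on $M$ by $*$-automorphisms, and let $p\in M$ be a non-zero projection. The corner $pMp$ carries the normalized trace $\tau_p=\tau(p)^{-1}\tau|_{pMp}$. A cocycle action $(\beta,v)$ of $G$ on a von Neumann algebra $N$ consists of maps $\beta:G\to\mathrm{Aut}(N)$ and $v:G\times G\to\mathcal U(N)$ with $\beta_e=\mathrm{id}$, $\beta_g\beta_h=\mathrm{Ad}(v_{g,h})\,\beta_{gh}$, $v_{g,h}v_{gh,k}=\beta_g(v_{h,k})v_{g,hk}$ and $v_{g,e}=v_{e,g}=1$ for all $g,h,k\in G$; an action is a cocycle action with $v=1$. It is properly outer if, for every $g\neq e$, $\beta_g$ is not of the form $\mathrm{Ad}(u)$ with $u\in\mathcal U(N)$. For a faithful normal tracial state $\tau_N$ on $N$, the crossed product $N\rtimes_{\beta}G=N\rtimes_{\beta,v}G$ is the von Neumann algebra on $\ell^2(G,L^2(N,\tau_N))$ generated by the copy of $N$ given by $(xf)(h)=\beta_h^{-1}(x)f(h)$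 and by the unitaries $u_g$, $(u_gf)(h)=\beta_h^{-1}(v_{g,g^{-1}h})f(g^{-1}h)$, so that $u_gx=\beta_g(x)u_g$ and $u_gu_h=v_{g,h}u_{gh}$. Then there exists a cocycle action $(\beta,v)$ of $G$ on $pMp$, which is properly outer if $\alpha$ is, such that the inclusions $$\bigl(pMp\subset p(M\rtimes_\alpha G)p\bigr)\simeq\bigl(pMp\subset pMp\rtimes_{\beta}G\bigr)$$ are isomorphic, i.e. there is a $*$-isomorphism of $p(M\rtimes_\alpha G)p$ onto $pMp\rtimes_{\beta}G$ that maps $pMp$ onto $pMp$. -/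

import Mathlib

open scoped ComplexOrder InnerProductSpace ENNReal

noncomputable section

universe u v

namespace VonNeumannAlgebra

variable {H : Type u} [NormedAddCommGroup H] [InnerProductSpace ℂ H] [CompleteSpace H]

instance instSMulMemClassComplex : SMulMemClass (VonNeumannAlgebra H) ℂ (H →L[ℂ] H) where
  smul_mem {S} c _ hx := S.toStarSubalgebra.smul_mem hx c

instance instIsClosedCoe (M : VonNeumannAlgebra H) : IsClosed (M : Set (H →L[ℂ] H)) := by
  rw [← M.centralizer_centralizer]
  exact Set.isClosed_centralizer _

/-- The elements of a von Neumann algebra, with the order of operators, form a star-ordered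
ring. -/
instance instStarOrderedRingCoe (M : VonNeumannAlgebra H) : StarOrderedRing M := by
  refine StarOrderedRing.of_nonneg_iff' (fun {x y} h z => ?_) (fun x => ⟨fun hx => ?_, ?_⟩)
  · exact add_le_add_right (show (x : H →L[ℂ] H) ≤ y from h) (z : H →L[ℂ] H)
  · have hx' : (0 : H →L[ℂ] H) ≤ x := hx
    have hmem : CFC.sqrt (x : H →L[ℂ] H) ∈ M := by
      rw [← SetLike.mem_coe, ← M.centralizer_centralizer]
      intro y hy
      have hc : Commute (x : H →L[ℂ] H) y := hy x x.2
      exact (hc.cfcₙ_nnreal _).symm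
    refine ⟨⟨_, hmem⟩, Subtype.ext ?_⟩
    have h1 : star (CFC.sqrt (x : H →L[ℂ] H)) = CFC.sqrt (x : H →L[ℂ] H) :=
      (IsSelfAdjoint.of_nonneg (CFC.sqrt_nonneg _)).star_eq
    show (x : H →L[ℂ] H) = star (CFC.sqrt (x : H →L[ℂ] H)) * CFC.sqrt (x : H →L[ℂ] H)
    rw [h1, CFC.sqrt_mul_sqrt_self _ hx']
  · rintro ⟨s, rfl⟩
    exact star_mul_self_nonneg (s : H →L[ℂ] H)

/-- `M` is a factor: its centre consists of the scalar multiples of the identity. -/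
def IsFactor (M : VonNeumannAlgebra H) : Prop :=
  ∀ x ∈ M, x ∈ M.commutant → ∃ c : ℂ, x = c • (1 : H →L[ℂ] H)

/-- A faithful normal tracial state on `M`. Normality is continuity in the ultraweak (σ-weak)
topology, i.e. being of the form `x ↦ ∑ₙ ⟨ξₙ, x ηₙ⟩` with square-summable `ξ`, `η`. -/
structure TraceState (M : VonNeumannAlgebra H) extends M →ₚ[ℂ] ℂ where
  map_one : toFun 1 = 1
  map_mul_comm : ∀ x y : M, toFun (x * y) = toFun (y * x)
  faithful : ∀ x : M, toFun (star x * x) = 0 → x = 0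
  normal : ∃ ξ η : ℕ → H, Summable (fun n => ‖ξ n‖ ^ 2) ∧ Summable (fun n => ‖η n‖ ^ 2) ∧
    ∀ x : M, HasSum (fun n => ⟪ξ n, (x : H →L[ℂ] H) (η n)⟫_ℂ) (toFun x)

/-- A II₁ factor: an infinite-dimensional factor with a faithful normal tracial state. -/
structure IsIIOneFactor (M : VonNeumannAlgebra H) : Prop where
  isFactor : M.IsFactor
  infinite : ¬ FiniteDimensional ℂ M
  trace : Nonempty M.TraceState

/-- The von Neumann algebra generated by a set of operators (the bicommutant of `s ∪ s*`). -/
def generatedBy (s : Set (H →L[ℂ] H)) : VonNeumannAlgebra H where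
  toStarSubalgebra :=
    StarSubalgebra.centralizer ℂ (StarSubalgebra.centralizer ℂ s : Set (H →L[ℂ] H))
  centralizer_centralizer' := by
    show Set.centralizer (Set.centralizer ((StarSubalgebra.centralizer ℂ
      (StarSubalgebra.centralizer ℂ s : Set (H →L[ℂ] H)) : Set (H →L[ℂ] H)))) =
      (StarSubalgebra.centralizer ℂ
        (StarSubalgebra.centralizer ℂ s : Set (H →L[ℂ] H)) : Set (H →L[ℂ] H))
    rw [StarSubalgebra.coe_centralizer_centralizer, Set.centralizer_centralizer_centralizer]

theorem subset_generatedBy (s : Set (H →L[ℂ] H)) : s ⊆ generatedBy s := by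
  intro x hx
  show x ∈ (StarSubalgebra.centralizer ℂ
        (StarSubalgebra.centralizer ℂ s : Set (H →L[ℂ] H)) : Set (H →L[ℂ] H))
  rw [StarSubalgebra.coe_centralizer_centralizer]
  exact Set.subset_centralizer_centralizer (Or.inl hx)

theorem generatedBy_le {s : Set (H →L[ℂ] H)} {N : VonNeumannAlgebra H}
    (h : s ⊆ N) : generatedBy s ≤ N := by
  intro x hx
  have hx' : x ∈ (StarSubalgebra.centralizer ℂ
        (StarSubalgebra.centralizer ℂ s : Set (H →L[ℂ] H)) : Set (H →L[ℂ] H)) := hx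
  rw [StarSubalgebra.coe_centralizer_centralizer] at hx'
  have h2 : s ∪ star s ⊆ (N : Set (H →L[ℂ] H)) := by
    rintro y (hy | hy)
    · exact h hy
    · simpa using star_mem (h hy)
  have := Set.centralizer_subset (Set.centralizer_subset h2) hx'
  rwa [N.centralizer_centralizer] at this

end VonNeumannAlgebra

/-! ### Corners -/

section Corner

variable {H : Type u} [NormedAddCommGroup H] [InnerProductSpace ℂ H] [CompleteSpace H]

/-- The Hilbert space `pH = {ξ | p ξ = ξ}` of a projection `p`. -/
def cornerSpace (p : H →L[ℂ] H) : Submodule ℂ H :=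
  LinearMap.eqLocus (p : H →ₗ[ℂ] H) ((1 : H →L[ℂ] H) : H →ₗ[ℂ] H)

set_option linter.unusedSectionVars false in
theorem mem_cornerSpace {p : H →L[ℂ] H} {ξ : H} : ξ ∈ cornerSpace p ↔ p ξ = ξ := Iff.rfl

instance instCompleteSpaceCornerSpace (p : H →L[ℂ] H) : CompleteSpace (cornerSpace p) := by
  have : IsClosed (cornerSpace p : Set H) := isClosed_eq p.continuous continuous_id
  exact this.completeSpace_coe

/-- An operator on `pH`, regarded as an operator on `H` that vanishes on the orthogonal
complement of `pH`. In this way `B(pH)` is identified with `p B(H) p`. -/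
def cornerExtend (p : H →L[ℂ] H) (T : cornerSpace p →L[ℂ] cornerSpace p) : H →L[ℂ] H :=
  (cornerSpace p).subtypeL ∘L T ∘L (cornerSpace p).orthogonalProjectionOnto

theorem starProjection_cornerSpace {p : H →L[ℂ] H} (hp : IsStarProjection p) :
    (cornerSpace p).starProjection = p := by
  ext ξ
  refine (Submodule.eq_starProjection_of_mem_of_inner_eq_zero (K := cornerSpace p) ?_ ?_)
  · rw [mem_cornerSpace]
    exact congrArg (fun q : H →L[ℂ] H => q ξ) hp.isIdempotentElem
  · intro η hη
    have h1 : ContinuousLinearMap.adjoint p = p := hp.isSelfAdjoint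
    rw [← mem_cornerSpace.1 hη, ← ContinuousLinearMap.adjoint_inner_left, h1, map_sub]
    have h2 : p (p ξ) = p ξ := congrArg (fun q : H →L[ℂ] H => q ξ) hp.isIdempotentElem
    rw [h2, sub_self, inner_zero_left]

section
variable (p : H →L[ℂ] H) (S T : cornerSpace p →L[ℂ] cornerSpace p)

theorem cornerExtend_add : cornerExtend p (S + T) = cornerExtend p S + cornerExtend p T := by
  ext; simp [cornerExtend]

theorem cornerExtend_smul (c : ℂ) : cornerExtend p (c • T) = c • cornerExtend p T := by
  ext; simp [cornerExtend]

theorem cornerExtend_mul : cornerExtend p (S * T) = cornerExtend p S * cornerExtend p T := by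
  ext; simp [cornerExtend]

theorem cornerExtend_star : cornerExtend p (star T) = star (cornerExtend p T) := by
  simp only [cornerExtend, ContinuousLinearMap.star_eq_adjoint, ContinuousLinearMap.adjoint_comp,
    Submodule.adjoint_subtypeL, Submodule.adjoint_orthogonalProjectionOnto]
  rfl

variable {p} in
theorem cornerExtend_one (hp : IsStarProjection p) : cornerExtend p 1 = p :=
  starProjection_cornerSpace hp

theorem cornerExtend_injective : Function.Injective (cornerExtend p) := by
  intro S T h
  ext ξ
  have := congrArg (fun q : H →L[ℂ] H => q ξ) h
  simpa [cornerExtend] using this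

end

theorem inner_cornerExtend (p : H →L[ℂ] H) (T : cornerSpace p →L[ℂ] cornerSpace p) (ξ η : H) :
    ⟪(cornerSpace p).orthogonalProjectionOnto ξ,
      T ((cornerSpace p).orthogonalProjectionOnto η)⟫_ℂ = ⟪ξ, cornerExtend p T η⟫_ℂ := by
  rw [← Submodule.adjoint_subtypeL, ContinuousLinearMap.adjoint_inner_left,
    Submodule.adjoint_subtypeL]
  rfl

theorem summable_corner (p : H →L[ℂ] H) (c : ℂ) {ξ η : ℕ → H}
    (hξ : Summable fun n => ‖ξ n‖ ^ 2) (hη : Summable fun n => ‖η n‖ ^ 2) :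
    (Summable fun n => ‖(cornerSpace p).orthogonalProjectionOnto (ξ n)‖ ^ 2) ∧
    (Summable fun n => ‖c • (cornerSpace p).orthogonalProjectionOnto (η n)‖ ^ 2) ∧
    ∀ (T : cornerSpace p →L[ℂ] cornerSpace p) (t : ℂ),
      HasSum (fun n => ⟪ξ n, cornerExtend p T (η n)⟫_ℂ) t →
      HasSum (fun n => ⟪(cornerSpace p).orthogonalProjectionOnto (ξ n),
        T (c • (cornerSpace p).orthogonalProjectionOnto (η n))⟫_ℂ) (c * t) := by
  have hle : ∀ ζ : H, ‖(cornerSpace p).orthogonalProjectionOnto ζ‖ ^ 2 ≤ ‖ζ‖ ^ 2 := fun ζ =>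
    pow_le_pow_left₀ (norm_nonneg _)
      (Submodule.norm_orthogonalProjectionOnto_apply_le (cornerSpace p) ζ) 2
  refine ⟨Summable.of_nonneg_of_le (fun _ => by positivity) (fun n => hle _) hξ, ?_, ?_⟩
  · have h1 : ∀ n, ‖c • (cornerSpace p).orthogonalProjectionOnto (η n)‖ ^ 2 =
        ‖c‖ ^ 2 * ‖(cornerSpace p).orthogonalProjectionOnto (η n)‖ ^ 2 := fun n => by
      rw [norm_smul, mul_pow]
    simp_rw [h1]
    exact (Summable.of_nonneg_of_le (fun _ => by positivity) (fun n => hle _) hη).mul_left _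
  · intro T t h
    simp_rw [map_smul, inner_smul_right, inner_cornerExtend]
    exact h.mul_left c

/-- The corner `pAp` of a *-algebra `A` of operators on `H` with `p ∈ A`, as a unital *-algebra
of operators on `pH`. -/
def StarSubalgebra.corner (A : StarSubalgebra ℂ (H →L[ℂ] H)) (p : H →L[ℂ] H)
    (hp : IsStarProjection p) (hpA : p ∈ A) :
    StarSubalgebra ℂ (cornerSpace p →L[ℂ] cornerSpace p) where
  carrier := {T | cornerExtend p T ∈ A}
  mul_mem' {S T} hS hT := by
    show cornerExtend p (S * T) ∈ A
    rw [cornerExtend_mul]; exact mul_mem hS hT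
  add_mem' {S T} hS hT := by
    show cornerExtend p (S + T) ∈ A
    rw [cornerExtend_add]; exact add_mem hS hT
  algebraMap_mem' c := by
    show cornerExtend p (algebraMap ℂ _ c) ∈ A
    rw [Algebra.algebraMap_eq_smul_one, cornerExtend_smul, cornerExtend_one hp]
    exact A.smul_mem hpA c
  star_mem' {T} hT := by
    show cornerExtend p (star T) ∈ A
    rw [cornerExtend_star]; exact star_mem hT

/-- The corner consists exactly of the compressions to `pH` of the elements of `A`, that is,
of the elements `pxp` with `x ∈ A` regarded as operators on `pH`. -/
theorem StarSubalgebra.mem_corner_iff (A : StarSubalgebra ℂ (H →L[ℂ] H)) (p : H →L[ℂ] H)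
    (hp : IsStarProjection p) (hpA : p ∈ A) (T : cornerSpace p →L[ℂ] cornerSpace p) :
    T ∈ A.corner p hp hpA ↔ ∃ x ∈ A, cornerExtend p T = p * x * p := by
  constructor
  · intro h
    refine ⟨cornerExtend p T, h, ?_⟩
    conv_lhs => rw [← one_mul T, ← mul_one (1 * T)]
    rw [cornerExtend_mul, cornerExtend_mul, cornerExtend_one hp]
  · rintro ⟨x, hx, h⟩
    show cornerExtend p T ∈ A
    rw [h]
    exact mul_mem (mul_mem hpA hx) hpA

namespace VonNeumannAlgebra

/-- The corner `pMp` of a von Neumann algebra `M` on `H`, as a von Neumann algebra on `pH`. -/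
def corner (M : VonNeumannAlgebra H) (p : H →L[ℂ] H) (hp : IsStarProjection p) (hpM : p ∈ M) :
    VonNeumannAlgebra (cornerSpace p) where
  toStarSubalgebra := M.toStarSubalgebra.corner p hp hpM
  centralizer_centralizer' := by
    refine Set.Subset.antisymm (fun T hT => ?_) Set.subset_centralizer_centralizer
    show cornerExtend p T ∈ (M : Set (H →L[ℂ] H))
    rw [← M.centralizer_centralizer]
    intro y hy
    have hyp : ∀ ξ : H, y (p ξ) = p (y ξ) := fun ξ =>
      congrArg (fun q : H →L[ℂ] H => q ξ) (hy p hpM).symm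
    let y' : cornerSpace p →L[ℂ] cornerSpace p := (y ∘L (cornerSpace p).subtypeL).codRestrict (cornerSpace p) (fun ξ => by
      have hξ : p (ξ : H) = ξ := ξ.2
      show p (y ξ) = y ξ
      rw [← hyp, hξ])
    have hproj : ∀ ξ : H, (((cornerSpace p).orthogonalProjectionOnto ξ : cornerSpace p) : H) = p ξ := fun ξ =>
      congrArg (fun q : H →L[ℂ] H => q ξ) (starProjection_cornerSpace hp)
    have hy' : y' ∈ Set.centralizer (M.toStarSubalgebra.corner p hp hpM).carrier := by
      intro S hS
      ext ξ
      have h1 := congrArg (fun q : H →L[ℂ] H => q (ξ : H)) (hy _ hS)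
      have h3 : (cornerSpace p).orthogonalProjectionOnto (y (ξ : H)) = y' ξ := by
        apply Subtype.ext
        rw [hproj, ← hyp]
        show y (p ξ) = y ξ
        rw [show p (ξ : H) = ξ from ξ.2]
      have h4 : ((S ((cornerSpace p).orthogonalProjectionOnto (y (ξ : H))) : cornerSpace p) : H)
          = y ((S ((cornerSpace p).orthogonalProjectionOnto (ξ : H)) : cornerSpace p) : H) := h1
      rw [h3, Submodule.orthogonalProjectionOnto_mem_subspace_eq_self] at h4
      exact h4
    have hc := (hT y' hy')
    ext ξ
    have h1 := congrArg (fun q : cornerSpace p →L[ℂ] cornerSpace p => ((q ((cornerSpace p).orthogonalProjectionOnto ξ) : cornerSpace p) : H)) hc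
    have h3 : y' ((cornerSpace p).orthogonalProjectionOnto ξ) = (cornerSpace p).orthogonalProjectionOnto (y ξ) := by
      apply Subtype.ext
      rw [hproj, ← hyp, ← hproj]
      rfl
    have h4 : y ((T ((cornerSpace p).orthogonalProjectionOnto ξ) : cornerSpace p) : H)
        = ((T (y' ((cornerSpace p).orthogonalProjectionOnto ξ)) : cornerSpace p) : H) := h1
    rw [h3] at h4
    exact h4

section
variable (M : VonNeumannAlgebra H) (p : H →L[ℂ] H) (hp : IsStarProjection p) (hpM : p ∈ M)

theorem mem_corner {T : cornerSpace p →L[ℂ] cornerSpace p} :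
    T ∈ M.corner p hp hpM ↔ cornerExtend p T ∈ M := Iff.rfl

/-- The (non-unital) inclusion `pMp ⊆ M`. -/
def cornerInclusion : M.corner p hp hpM →ₗ[ℂ] M where
  toFun T := ⟨cornerExtend p T, T.2⟩
  map_add' S T := Subtype.ext (cornerExtend_add p S T)
  map_smul' c T := Subtype.ext (cornerExtend_smul p T c)

theorem cornerInclusion_mul (S T : M.corner p hp hpM) :
    M.cornerInclusion p hp hpM (S * T) =
      M.cornerInclusion p hp hpM S * M.cornerInclusion p hp hpM T :=
  Subtype.ext (cornerExtend_mul p S T)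

theorem cornerInclusion_star (T : M.corner p hp hpM) :
    M.cornerInclusion p hp hpM (star T) = star (M.cornerInclusion p hp hpM T) :=
  Subtype.ext (cornerExtend_star p T)

theorem cornerInclusion_one :
    M.cornerInclusion p hp hpM 1 = ⟨p, hpM⟩ :=
  Subtype.ext (cornerExtend_one hp)

end

section
variable {M : VonNeumannAlgebra H} (τ : M.TraceState) (p : H →L[ℂ] H)
  (hp : IsStarProjection p) (hpM : p ∈ M)

theorem TraceState.map_projection_pos (τ : M.TraceState) (p : H →L[ℂ] H)
    (hp : IsStarProjection p) (hpM : p ∈ M) (hp0 : p ≠ 0) :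
    0 < τ.toPositiveLinearMap ⟨p, hpM⟩ := by
  have h1 : star (⟨p, hpM⟩ : M) * ⟨p, hpM⟩ = ⟨p, hpM⟩ := by
    apply Subtype.ext
    show star p * p = p
    rw [hp.isSelfAdjoint.star_eq, hp.isIdempotentElem]
  have h2 : 0 ≤ τ.toPositiveLinearMap ⟨p, hpM⟩ := by
    rw [← h1]
    exact τ.toPositiveLinearMap.map_nonneg (star_mul_self_nonneg _)
  refine lt_of_le_of_ne h2 fun h => hp0 ?_
  have := τ.faithful ⟨p, hpM⟩ (by rw [h1]; exact h.symm)
  exact congrArg Subtype.val this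

/-- The normalized trace `x ↦ τ(x) / τ(p)` on the corner `pMp`. -/
def TraceState.corner (hp0 : p ≠ 0) : (M.corner p hp hpM).TraceState where
  toPositiveLinearMap := PositiveLinearMap.mk₀
    ((τ.toPositiveLinearMap ⟨p, hpM⟩)⁻¹ •
      (τ.toPositiveLinearMap.toLinearMap ∘ₗ M.cornerInclusion p hp hpM)) (by
      intro T hT
      obtain ⟨S, rfl⟩ := CStarAlgebra.nonneg_iff_eq_star_mul_self.1 hT
      have h2 := τ.toPositiveLinearMap.map_nonneg
        (star_mul_self_nonneg (M.cornerInclusion p hp hpM S))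
      rw [← cornerInclusion_star, ← cornerInclusion_mul] at h2
      have h1 : 0 ≤ (τ.toPositiveLinearMap ⟨p, hpM⟩)⁻¹ :=
        (RCLike.inv_pos_of_pos (τ.map_projection_pos p hp hpM hp0)).le
      exact mul_nonneg h1 h2)
  map_one := by
    show (τ.toPositiveLinearMap ⟨p, hpM⟩)⁻¹ *
      τ.toPositiveLinearMap (M.cornerInclusion p hp hpM 1) = 1
    rw [cornerInclusion_one]
    exact inv_mul_cancel₀ (τ.map_projection_pos p hp hpM hp0).ne'
  map_mul_comm S T := by
    show (τ.toPositiveLinearMap ⟨p, hpM⟩)⁻¹ *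
      τ.toPositiveLinearMap (M.cornerInclusion p hp hpM (S * T)) =
      (τ.toPositiveLinearMap ⟨p, hpM⟩)⁻¹ *
      τ.toPositiveLinearMap (M.cornerInclusion p hp hpM (T * S))
    rw [cornerInclusion_mul, cornerInclusion_mul]
    congr 1
    exact τ.map_mul_comm _ _
  faithful T hT := by
    have hT' : (τ.toPositiveLinearMap ⟨p, hpM⟩)⁻¹ *
      τ.toPositiveLinearMap (M.cornerInclusion p hp hpM (star T * T)) = 0 := hT
    rw [cornerInclusion_mul, cornerInclusion_star] at hT'
    have h1 := (mul_eq_zero.1 hT').resolve_left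
      (inv_ne_zero (τ.map_projection_pos p hp hpM hp0).ne')
    have h2 := congrArg Subtype.val (τ.faithful _ h1)
    apply Subtype.ext
    apply cornerExtend_injective p
    rw [show cornerExtend p (T : cornerSpace p →L[ℂ] cornerSpace p) = 0 from h2]
    ext ξ
    simp [cornerExtend]
  normal := by
    obtain ⟨ξ, η, hξ, hη, h⟩ := τ.normal
    obtain ⟨h1, h2, h3⟩ := summable_corner p (τ.toPositiveLinearMap ⟨p, hpM⟩)⁻¹ hξ hη
    exact ⟨_, _, h1, h2, fun T => h3 T _ (h (M.cornerInclusion p hp hpM T))⟩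

end

end VonNeumannAlgebra

end Corner

/-! ### Cocycle actions and crossed products -/

section CrossedProduct

variable {H : Type u} [NormedAddCommGroup H] [InnerProductSpace ℂ H] [CompleteSpace H]
variable {G : Type v} [Group G]

/-- A cocycle action `(α, v)` of a discrete group `G` on a von Neumann algebra `M`, with
normalized 2-cocycle `v`. -/
structure CocycleAction (G : Type v) [Group G] (M : VonNeumannAlgebra H) where
  act : G → (M ≃⋆ₐ[ℂ] M)
  cocycle : G → G → unitary M
  act_one : act 1 = 1
  act_act : ∀ g h (x : M),
    act g (act h x) = (cocycle g h : M) * act (g * h) x * star (cocycle g h : M)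
  cocycle_rel : ∀ g h k, (cocycle g h : M) * (cocycle (g * h) k : M) =
    act g (cocycle h k : M) * (cocycle g (h * k) : M)
  cocycle_one_right : ∀ g, cocycle g 1 = 1
  cocycle_one_left : ∀ g, cocycle 1 g = 1

/-- An action of `G` on `M` by automorphisms, as a cocycle action with trivial 2-cocycle. -/
def CocycleAction.ofAction {M : VonNeumannAlgebra H} (α : G →* (M ≃⋆ₐ[ℂ] M)) :
    CocycleAction G M where
  act := α
  cocycle _ _ := 1
  act_one := map_one α
  act_act g h x := by simp
  cocycle_rel g h k := by simp
  cocycle_one_right _ := rfl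
  cocycle_one_left _ := rfl

/-- `α` is properly outer: for `g ≠ 1`, `α_g` is not implemented by a unitary of `M`. -/
def CocycleAction.IsProperlyOuter {M : VonNeumannAlgebra H} (α : CocycleAction G M) : Prop :=
  ∀ g : G, g ≠ 1 → ¬ ∃ u : unitary M, ∀ x : M, α.act g x = (u : M) * x * star (u : M)

/-- `L²(M, τ)`: the completion of `M` for the inner product `⟨x, y⟩ = τ(x* y)`. -/
def VonNeumannAlgebra.TraceState.L2 {M : VonNeumannAlgebra H} (τ : M.TraceState) : Type u :=
  τ.toPositiveLinearMap.GNS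

instance instNormedAddCommGroupL2 {M : VonNeumannAlgebra H} (τ : M.TraceState) :
    NormedAddCommGroup τ.L2 :=
  inferInstanceAs (NormedAddCommGroup τ.toPositiveLinearMap.GNS)

instance instInnerProductSpaceL2 {M : VonNeumannAlgebra H} (τ : M.TraceState) :
    InnerProductSpace ℂ τ.L2 :=
  inferInstanceAs (InnerProductSpace ℂ τ.toPositiveLinearMap.GNS)

instance instCompleteSpaceL2 {M : VonNeumannAlgebra H} (τ : M.TraceState) :
    CompleteSpace τ.L2 :=
  inferInstanceAs (CompleteSpace τ.toPositiveLinearMap.GNS)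

/-- The action of `M` on `L²(M, τ)` by left multiplication. -/
def VonNeumannAlgebra.TraceState.leftMul {M : VonNeumannAlgebra H} (τ : M.TraceState) :
    M →⋆ₐ[ℂ] (τ.L2 →L[ℂ] τ.L2) :=
  τ.toPositiveLinearMap.gnsStarAlgHom

section WeightedPermutation

variable {E : Type u} [NormedAddCommGroup E] [InnerProductSpace ℂ E]

theorem sum_norm_weighted_le (σ : G ≃ G) (T : G → E →L[ℂ] E) (C : ℝ) (hT : ∀ g, ‖T g‖ ≤ C)
    (f : lp (fun _ : G => E) 2) (s : Finset G) :
    ∑ g ∈ s, ‖T g (f (σ g))‖ ^ (2 : ℝ≥0∞).toReal ≤ (C * ‖f‖) ^ (2 : ℝ≥0∞).toReal := by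
  have hC : 0 ≤ C := (norm_nonneg _).trans (hT 1)
  have h2 : 0 < (2 : ℝ≥0∞).toReal := by norm_num
  calc ∑ g ∈ s, ‖T g (f (σ g))‖ ^ (2 : ℝ≥0∞).toReal
      ≤ ∑ g ∈ s, C ^ (2 : ℝ≥0∞).toReal * ‖f (σ g)‖ ^ (2 : ℝ≥0∞).toReal := by
        refine Finset.sum_le_sum fun g _ => ?_
        rw [← Real.mul_rpow hC (norm_nonneg _)]
        exact Real.rpow_le_rpow (norm_nonneg _) ((T g).le_of_opNorm_le (hT g) _) h2.le
    _ = C ^ (2 : ℝ≥0∞).toReal * ∑ g ∈ s.map σ.toEmbedding, ‖f g‖ ^ (2 : ℝ≥0∞).toReal := by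
        rw [Finset.sum_map, Finset.mul_sum]
        rfl
    _ ≤ C ^ (2 : ℝ≥0∞).toReal * ‖f‖ ^ (2 : ℝ≥0∞).toReal :=
        mul_le_mul_of_nonneg_left (lp.sum_rpow_le_norm_rpow h2 f _) (Real.rpow_nonneg hC _)
    _ = (C * ‖f‖) ^ (2 : ℝ≥0∞).toReal := (Real.mul_rpow hC (norm_nonneg _)).symm

/-- The operator `f ↦ (g ↦ T_g f(σ(g)))` on `ℓ²(G, E)`, for a uniformly bounded family of
operators `T_g` on `E` and a permutation `σ` of `G`. -/
def weightedPerm (σ : G ≃ G) (T : G → E →L[ℂ] E) (C : ℝ) (hT : ∀ g, ‖T g‖ ≤ C) :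
    lp (fun _ : G => E) 2 →L[ℂ] lp (fun _ : G => E) 2 :=
  LinearMap.mkContinuous
    { toFun := fun f => ⟨fun g => T g (f (σ g)),
        memℓp_gen' (sum_norm_weighted_le σ T C hT f)⟩
      map_add' := fun f f' => lp.ext (funext fun g => map_add (T g) _ _)
      map_smul' := fun c f => lp.ext (funext fun g => map_smul (T g) c _) }
    C (fun f => lp.norm_le_of_forall_sum_le (by norm_num)
      (mul_nonneg ((norm_nonneg _).trans (hT 1)) (norm_nonneg _))
      (sum_norm_weighted_le σ T C hT f))

@[simp]
theorem weightedPerm_apply (σ : G ≃ G) (T : G → E →L[ℂ] E) (C : ℝ) (hT : ∀ g, ‖T g‖ ≤ C)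
    (f : lp (fun _ : G => E) 2) (g : G) : weightedPerm σ T C hT f g = T g (f (σ g)) := rfl

end WeightedPermutation

namespace CocycleAction

variable {M : VonNeumannAlgebra H} (α : CocycleAction G M) (τ : M.TraceState)

/-- The Hilbert space `ℓ²(G, L²(M, τ))`. -/
abbrev Space (_α : CocycleAction G M) (τ : M.TraceState) : Type (max u v) :=
  lp (fun _ : G => τ.L2) 2

theorem norm_leftMul_le (x : M) (e : M ≃⋆ₐ[ℂ] M) : ‖τ.leftMul (e x)‖ ≤ ‖x‖ :=
  (NonUnitalStarAlgHom.norm_apply_le τ.leftMul (e x)).trans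
    (NonUnitalStarAlgHom.norm_apply_le e x)

theorem norm_unitary_le (_τ : M.TraceState) (u : unitary M) : ‖(u : M)‖ ≤ 1 := by
  have : Nontrivial M := by
    refine ⟨⟨0, 1, fun h => ?_⟩⟩
    have h1 : _τ.toPositiveLinearMap 1 = 1 := _τ.map_one
    rw [← h, map_zero] at h1
    exact zero_ne_one h1
  exact (CStarRing.norm_coe_unitary u).le

/-- The copy of `M` in the crossed product: `(x f)(g) = α_g⁻¹(x) f(g)`. -/
def base : M →⋆ₐ[ℂ] (α.Space τ →L[ℂ] α.Space τ) where
  toFun x := weightedPerm (Equiv.refl G) (fun g => τ.leftMul ((α.act g).symm x)) ‖x‖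
    (fun g => norm_leftMul_le τ x (α.act g).symm)
  map_one' := by ext f g; simp
  map_mul' x y := by ext f g; simp
  map_zero' := by ext f g; simp
  map_add' x y := by ext f g; simp
  commutes' c := by ext f g; simp [Algebra.algebraMap_eq_smul_one]
  map_star' x := by
    rw [ContinuousLinearMap.star_eq_adjoint, ContinuousLinearMap.eq_adjoint_iff]
    intro f f'
    rw [lp.inner_eq_tsum, lp.inner_eq_tsum]
    refine tsum_congr fun g => ?_
    rw [weightedPerm_apply, weightedPerm_apply, map_star, map_star,
      ContinuousLinearMap.star_eq_adjoint, ContinuousLinearMap.adjoint_inner_left]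
    rfl

/-- The operators implementing the action: `(u_g f)(h) = α_h⁻¹(v_{g, g⁻¹h}) f(g⁻¹h)`.
They satisfy `u_g x u_g* = α_g(x)` and `u_g u_h = v_{g,h} u_{gh}`. -/
def implementing (g : G) : α.Space τ →L[ℂ] α.Space τ :=
  weightedPerm (Equiv.mulLeft g⁻¹)
    (fun h => τ.leftMul ((α.act h).symm (α.cocycle g (g⁻¹ * h) : M))) 1
    (fun h => (norm_leftMul_le τ _ (α.act h).symm).trans
      (norm_unitary_le τ _))

/-- The crossed product `M ⋊_{α,v} G`: the von Neumann algebra on `ℓ²(G, L²(M, τ))` generated by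
the copy of `M` and the operators `u_g`. -/
def crossedProduct : VonNeumannAlgebra (α.Space τ) :=
  VonNeumannAlgebra.generatedBy (Set.range (α.base τ) ∪ Set.range (α.implementing τ))

/-- The image of `M` in the crossed product. -/
def baseAlgebra : StarSubalgebra ℂ (α.Space τ →L[ℂ] α.Space τ) := (α.base τ).range

theorem base_mem_baseAlgebra (x : M) : α.base τ x ∈ α.baseAlgebra τ := ⟨x, rfl⟩

theorem isStarProjection_base {p : H →L[ℂ] H} (hp : IsStarProjection p) (hpM : p ∈ M) :
    IsStarProjection (α.base τ ⟨p, hpM⟩) :=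
  IsStarProjection.map (x := (⟨p, hpM⟩ : M))
    ⟨Subtype.ext hp.isIdempotentElem, Subtype.ext hp.isSelfAdjoint⟩ (α.base τ)

theorem base_mem_crossedProduct (x : M) : α.base τ x ∈ α.crossedProduct τ :=
  VonNeumannAlgebra.subset_generatedBy _ (Or.inl ⟨x, rfl⟩)

end CocycleAction

/-- For unital inclusions `A₁ ⊆ N₁` and `A₂ ⊆ N₂`: the inclusions are isomorphic if there is a
*-isomorphism of `N₁` onto `N₂` that maps `A₁` onto `A₂`. -/
def IsomorphicInclusions {K₁ : Type*} {K₂ : Type*}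
    [NormedAddCommGroup K₁] [InnerProductSpace ℂ K₁] [CompleteSpace K₁]
    [NormedAddCommGroup K₂] [InnerProductSpace ℂ K₂] [CompleteSpace K₂]
    (A₁ : StarSubalgebra ℂ (K₁ →L[ℂ] K₁)) (N₁ : VonNeumannAlgebra K₁)
    (A₂ : StarSubalgebra ℂ (K₂ →L[ℂ] K₂)) (N₂ : VonNeumannAlgebra K₂) : Prop :=
  A₁ ≤ N₁.toStarSubalgebra ∧ A₂ ≤ N₂.toStarSubalgebra ∧
    ∃ Φ : N₁ ≃⋆ₐ[ℂ] N₂,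
      Φ '' {x : N₁ | (x : K₁ →L[ℂ] K₁) ∈ A₁} = {y : N₂ | (y : K₂ →L[ℂ] K₂) ∈ A₂}

end CrossedProduct

end

/-! Since `M` is a factor with a faithful trace, projections are comparable and every automorphism
preserves their trace. So `p` and `α_g(p)` are equivalent: there are `w_g ∈ M` with `w_g w_g* = p`,
`w_g* w_g = α_g(p)` and `w_1 = p`. In `N = M ⋊ G` the elements `w_g u_g` are unitaries of `pNp`
normalizing `pMp`, and the cocycle action is read off from them: `β_g(x) = w_g α_g(x) w_g*` and
`v_{g,h} = w_g α_g(w_h) w_{gh}*`.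

The isomorphism is spatial. Put `(J f)(h) = α_h⁻¹(w_h) f(h)`, an isometry of `ℓ²(G, L²(pMp))` into
`ℓ²(G, L²(M))` with range projection `P Q`, where `P ∈ N` is the copy of `p` and `Q ∈ N'` is right
multiplication by `p`. The compression `T ↦ J* T J` is multiplicative on `PNP`, carries the copy of
`pMp` in `N` to its copy in `pMp ⋊ G`, and sends `w_g u_g` to the implementing unitary of `β_g`. To
see that it is a bijection onto the whole crossed product, divide `1` by `p`: there are finitely
many `r_i = r_i p` in `M` with `∑ r_i r_i* = 1`. Left and right multiplications by these elements
make `P` full in `N` and `Q` full in `N'`, so elements are lifted through the compression by finite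
sums.

The same family gives proper outerness: if `β_g = Ad u`, then `∑ α_g(r_i) w_g* u r_i*` is a unitary
of `M` implementing `α_g`.

The load is carried by `IsFactor.comparison`, `IsFaithfulTrace.exists_equiv_map`,
`IsFaithfulTrace.exists_division`, `IsTransport.exists_unitary_of_corner` and
`IsReduction.compressHom_bijective`. -/

noncomputable section

/-! ### Partial isometries determined by families of vectors -/

section PartialIsometry

variable {H₁ H₂ : Type*} [NormedAddCommGroup H₁] [InnerProductSpace ℂ H₁] [CompleteSpace H₁]
  [NormedAddCommGroup H₂] [InnerProductSpace ℂ H₂]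

/-- Two bounded operators that agree on a family and on its orthogonal complement are equal. -/
theorem ContinuousLinearMap.ext_of_family {ι : Type*} (a : ι → H₁) {S T : H₁ →L[ℂ] H₂}
    (h : ∀ i, S (a i) = T (a i)) (h' : ∀ ξ, (∀ i, ⟪a i, ξ⟫_ℂ = 0) → S ξ = T ξ) : S = T := by
  have hK : IsClosed
      ((LinearMap.ker (S - T : H₁ →L[ℂ] H₂).toLinearMap : Submodule ℂ H₁) : Set H₁) :=
    (S - T).isClosed_ker
  have : CompleteSpace (LinearMap.ker (S - T : H₁ →L[ℂ] H₂).toLinearMap) := hK.completeSpace_coe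
  have ha : ∀ i, a i ∈ LinearMap.ker (S - T : H₁ →L[ℂ] H₂).toLinearMap := fun i => by
    simp [h i]
  -- A vector orthogonal to the kernel is orthogonal to all `a i`, so `h'` puts it in the kernel as
  -- well; it is then orthogonal to itself.
  have hperp : (LinearMap.ker (S - T : H₁ →L[ℂ] H₂).toLinearMap)ᗮ = ⊥ := by
    rw [eq_bot_iff]
    intro ξ hξ
    have h1 : ξ ∈ LinearMap.ker (S - T : H₁ →L[ℂ] H₂).toLinearMap := by
      simp [h' ξ (fun i => (Submodule.mem_orthogonal _ _).1 hξ _ (ha i))]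
    have := (Submodule.mem_orthogonal _ _).1 hξ _ h1
    simpa using this
  have htop := (Submodule.orthogonal_eq_bot_iff).1 hperp
  ext ξ
  have : ξ ∈ LinearMap.ker (S - T : H₁ →L[ℂ] H₂).toLinearMap := htop ▸ Submodule.mem_top
  simpa [sub_eq_zero] using this

/-- Families with the same Gram matrix are related by a partial isometry. -/
theorem exists_partialIsometry [CompleteSpace H₂] {ι : Type*} (a : ι → H₁) (b : ι → H₂)
    (hab : ∀ i j, ⟪a i, a j⟫_ℂ = ⟪b i, b j⟫_ℂ) :
    ∃ V : H₁ →L[ℂ] H₂, (∀ i, V (a i) = b i) ∧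
      (∀ ξ, (∀ i, ⟪a i, ξ⟫_ℂ = 0) → V ξ = 0) ∧
      (∀ i, ContinuousLinearMap.adjoint V (b i) = a i) := by
  let K : Submodule ℂ H₁ := (Submodule.span ℂ (Set.range a)).topologicalClosure
  have hK : IsClosed (K : Set H₁) := Submodule.isClosed_topologicalClosure _
  have : CompleteSpace K := hK.completeSpace_coe
  have haK : ∀ i, a i ∈ K := fun i =>
    Submodule.le_topologicalClosure _ (Submodule.subset_span ⟨i, rfl⟩)
  let e : (ι →₀ ℂ) →ₗ[ℂ] K := Finsupp.linearCombination ℂ (fun i => (⟨a i, haK i⟩ : K))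
  let f : (ι →₀ ℂ) →ₗ[ℂ] H₂ := Finsupp.linearCombination ℂ b
  have he : ∀ x, (e x : H₁) = Finsupp.linearCombination ℂ a x := fun x => by
    simp [e, Finsupp.linearCombination_apply, Finsupp.sum]
  have hdense : DenseRange e := by
    rw [DenseRange, Subtype.dense_iff]
    have h1 : ((↑) : K → H₁) '' Set.range e = (Submodule.span ℂ (Set.range a) : Set H₁) := by
      ext ξ
      rw [SetLike.mem_coe, Finsupp.mem_span_range_iff_exists_finsupp]
      simp only [Set.mem_image, Set.mem_range, exists_exists_eq_and, he]
      rfl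
    exact fun ξ hξ => (congrArg closure h1).ge hξ
  have hinner : ∀ x y, ⟪e x, e y⟫_ℂ = ⟪f x, f y⟫_ℂ := by
    intro x y
    rw [Submodule.coe_inner, he, he]
    simp only [f, Finsupp.linearCombination_apply, Finsupp.sum, sum_inner, inner_sum,
      inner_smul_left, inner_smul_right, hab]
  have hnorm : ∀ x, ‖f x‖ ≤ 1 * ‖e x‖ := fun x => by
    rw [one_mul, @norm_eq_sqrt_re_inner ℂ, @norm_eq_sqrt_re_inner ℂ _ _ _ _ (e x), hinner]
  let V₀ : K →L[ℂ] H₂ := f.extendOfNorm e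
  have hV₀ : ∀ x, V₀ (e x) = f x := LinearMap.extendOfNorm_eq hdense ⟨1, hnorm⟩
  have hV₀a : ∀ i, V₀ ⟨a i, haK i⟩ = b i := fun i => by
    simpa [e, f] using hV₀ (Finsupp.single i 1)
  have hV : ∀ i, (V₀ ∘L K.orthogonalProjectionOnto) (a i) = b i := fun i => by
    rw [← hV₀a i]
    exact congrArg V₀ (Submodule.orthogonalProjectionOnto_mem_subspace_eq_self (K := K)
      ⟨a i, haK i⟩)
  have hperp : ∀ ξ, (∀ i, ⟪a i, ξ⟫_ℂ = 0) → ξ ∈ Kᗮ := by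
    intro ξ hξ
    rw [Submodule.orthogonal_closure, Submodule.mem_orthogonal]
    intro η hη
    induction hη using Submodule.span_induction with
    | mem x hx => obtain ⟨i, rfl⟩ := hx; exact hξ i
    | zero => simp
    | add x y _ _ hx hy => rw [inner_add_left, hx, hy, add_zero]
    | smul c x _ hx => rw [inner_smul_left, hx, mul_zero]
  have hV' : ∀ ξ, (∀ i, ⟪a i, ξ⟫_ℂ = 0) → (V₀ ∘L K.orthogonalProjectionOnto) ξ = 0 := by
    intro ξ hξ
    have : K.orthogonalProjectionOnto ξ = 0 :=
      (Submodule.orthogonalProjectionOnto_eq_zero_iff).2 (hperp ξ hξ)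
    simp [this]
  refine ⟨V₀ ∘L K.orthogonalProjectionOnto, hV, hV', fun i => ?_⟩
  -- The formula for the adjoint says that two functionals agree, which can be tested on the family
  -- and on its orthogonal complement.
  have : (innerSL ℂ (b i)) ∘L (V₀ ∘L K.orthogonalProjectionOnto) = innerSL ℂ (a i) := by
    refine ContinuousLinearMap.ext_of_family a (fun j => ?_) (fun ξ hξ => ?_)
    · show ⟪b i, (V₀ ∘L K.orthogonalProjectionOnto) (a j)⟫_ℂ = ⟪a i, a j⟫_ℂ
      rw [hV, hab]
    · show ⟪b i, (V₀ ∘L K.orthogonalProjectionOnto) ξ⟫_ℂ = ⟪a i, ξ⟫_ℂ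
      rw [hV' ξ hξ, hξ, inner_zero_right]
  refine ext_inner_right ℂ fun ξ => ?_
  rw [ContinuousLinearMap.adjoint_inner_left]
  exact congrArg (fun q : H₁ →L[ℂ] ℂ => q ξ) this

/-- Families with the same Gram matrix are related by a partial isometry that intertwines every
operator permuting the indices of both families. -/
theorem exists_partialIsometry_commute {H : Type*} [NormedAddCommGroup H] [InnerProductSpace ℂ H]
    [CompleteSpace H] {ι : Type*} (a b : ι → H) (hab : ∀ i j, ⟪a i, a j⟫_ℂ = ⟪b i, b j⟫_ℂ) :
    ∃ V : H →L[ℂ] H, (∀ i, V (a i) = b i) ∧ (∀ ξ, (∀ i, ⟪a i, ξ⟫_ℂ = 0) → V ξ = 0) ∧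
      (∀ i, star V (b i) = a i) ∧ V * star V * V = V ∧
      (∀ p : H →L[ℂ] H, IsSelfAdjoint p → (∀ i, p (a i) = a i) → V * p = V) ∧
      (∀ q : H →L[ℂ] H, (∀ i, q (b i) = b i) → q * V = V) ∧
      ∀ y : H →L[ℂ] H, (∀ i, ∃ j, y (a i) = a j ∧ y (b i) = b j) →
        (∀ i, ∃ j, star y (a i) = a j) → y * V = V * y := by
  obtain ⟨V, h1, h2, h3⟩ := exists_partialIsometry a b hab
  refine ⟨V, h1, h2, h3, ?_, fun p hp hpa => ?_, fun q hq => ?_, fun y hy hy' => ?_⟩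
  · refine ContinuousLinearMap.ext_of_family a (fun i => ?_) (fun ξ hξ => ?_)
    · show V (ContinuousLinearMap.adjoint V (V (a i))) = V (a i)
      rw [h1, h3, h1]
    · show V (ContinuousLinearMap.adjoint V (V ξ)) = V ξ
      rw [h2 ξ hξ]; simp
  · refine ContinuousLinearMap.ext_of_family a (fun i => ?_) (fun ξ hξ => ?_)
    · exact congrArg V (hpa i)
    · show V (p ξ) = V ξ
      rw [h2 ξ hξ, h2 (p ξ)]
      intro i
      rw [← ContinuousLinearMap.adjoint_inner_left]
      exact (congrArg (fun η => ⟪η, ξ⟫_ℂ)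
        ((congrArg (fun T : H →L[ℂ] H => T (a i)) hp).trans (hpa i))).trans (hξ i)
  · refine ContinuousLinearMap.ext_of_family a (fun i => ?_) (fun ξ hξ => ?_)
    · show q (V (a i)) = V (a i)
      rw [h1, hq]
    · show q (V ξ) = V ξ
      rw [h2 ξ hξ, map_zero]
  · refine ContinuousLinearMap.ext_of_family a (fun i => ?_) (fun ξ hξ => ?_)
    · obtain ⟨j, hj, hj'⟩ := hy i
      show y (V (a i)) = V (y (a i))
      rw [h1, hj, hj', h1]
    · show y (V ξ) = V (y ξ)
      rw [h2 ξ hξ, h2 (y ξ), map_zero]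
      intro i
      obtain ⟨j, hj⟩ := hy' i
      rw [← ContinuousLinearMap.adjoint_inner_left]
      exact (congrArg (fun η => ⟪η, ξ⟫_ℂ) hj).trans (hξ j)

end PartialIsometry

/-! ### Polar decomposition and comparison of projections in a factor -/

namespace VonNeumannAlgebra

variable {H : Type u} [NormedAddCommGroup H] [InnerProductSpace ℂ H] [CompleteSpace H]

theorem mem_of_commute (M : VonNeumannAlgebra H) {x : H →L[ℂ] H}
    (h : ∀ y ∈ M.commutant, y * x = x * y) : x ∈ M := by
  rw [← M.commutant_commutant, mem_commutant_iff]
  exact h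

theorem commute_of_mem (M : VonNeumannAlgebra H) {x y : H →L[ℂ] H} (hx : x ∈ M)
    (hy : y ∈ M.commutant) : x * y = y * x :=
  mem_commutant_iff.1 hy x hx

/-- The polar decomposition within a von Neumann algebra. -/
theorem exists_polar (M : VonNeumannAlgebra H) {x : H →L[ℂ] H} (hx : x ∈ M) :
    ∃ V ∈ M, ∃ h ∈ M, V * h = x ∧ V * star V * V = V ∧
      (∀ p : H →L[ℂ] H, IsStarProjection p → x * p = x → V * p = V) ∧
      (∀ q : H →L[ℂ] H, q * x = x → q * V = V) := by
  have hpos : (0 : H →L[ℂ] H) ≤ star x * x := star_mul_self_nonneg x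
  set h := CFC.sqrt (star x * x) with hh
  have hsa : star h = h := (IsSelfAdjoint.of_nonneg (CFC.sqrt_nonneg _)).star_eq
  have hsq : h * h = star x * x := CFC.sqrt_mul_sqrt_self _ hpos
  have hmem : h ∈ M := by
    refine M.mem_of_commute fun y hy => ?_
    have hc : Commute (star x * x) y := M.commute_of_mem (mul_mem (star_mem hx) hx) hy
    exact (hc.cfcₙ_nnreal _).symm
  have hinner : ∀ ξ η : H, ⟪h ξ, h η⟫_ℂ = ⟪x ξ, x η⟫_ℂ := by
    intro ξ η
    rw [← ContinuousLinearMap.adjoint_inner_right, ← ContinuousLinearMap.adjoint_inner_right x]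
    exact congrArg (fun T : H →L[ℂ] H => ⟪ξ, T η⟫_ℂ) (show star h * h = star x * x by rw [hsa, hsq])
  obtain ⟨V, h1, h2, h3, h4, h5, h6, h7⟩ :=
    exists_partialIsometry_commute (fun ξ => h ξ) (fun ξ => x ξ) hinner
  have hcm : ∀ y ∈ M.commutant, ∀ z ∈ M, ∀ ξ, y (z ξ) = z (y ξ) := fun y hy z hz ξ =>
    (congrArg (fun T : H →L[ℂ] H => T ξ) (M.commute_of_mem hz hy)).symm
  -- An operator `y` of the commutant sends `h ξ` to `h (y ξ)` and `x ξ` to `x (y ξ)`. It permutes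
  -- the indices of both families, hence commutes with `V`, and the bicommutant theorem gives `V ∈
  -- M`.
  refine ⟨V, M.mem_of_commute fun y hy => h7 y (fun ξ => ⟨y ξ, hcm y hy h hmem ξ, hcm y hy x hx ξ⟩)
    (fun ξ => ⟨star y ξ, hcm _ (star_mem hy) h hmem ξ⟩), h, hmem, ?_, h4, ?_, ?_⟩
  · ext ξ; exact h1 ξ
  · intro p hp hxp
    -- The vectors `h ζ` and `x ζ` have equal norms; take `ζ = p ξ - ξ`, which `x` kills.
    have hhp : h * p = h := by
      ext ξ
      rw [← sub_eq_zero, ← inner_self_eq_zero (𝕜 := ℂ)]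
      show ⟪h (p ξ) - h ξ, h (p ξ) - h ξ⟫_ℂ = 0
      rw [← map_sub, hinner, map_sub]
      have : x (p ξ) = x ξ := congrArg (fun T : H →L[ℂ] H => T ξ) hxp
      rw [this, sub_self, inner_zero_left]
    have hph : p * h = h := by
      have := congrArg star hhp
      rwa [star_mul, hsa, hp.isSelfAdjoint.star_eq] at this
    exact h5 p hp.isSelfAdjoint fun ξ => congrArg (fun T : H →L[ℂ] H => T ξ) hph
  · exact fun q hq => h6 q fun ξ => congrArg (fun T : H →L[ℂ] H => T ξ) hq

/-- In a factor, non-zero elements are linked. -/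
theorem IsFactor.exists_mul_mul_ne_zero {M : VonNeumannAlgebra H} (hM : M.IsFactor)
    {p q : H →L[ℂ] H} (hp : p ∈ M) (hp0 : p ≠ 0) (hq0 : q ≠ 0) :
    ∃ y ∈ M, q * y * p ≠ 0 := by
  by_contra! hcon
  -- With both families equal, `z` is the projection onto the closed span of `M p H`. The commutant
  -- moves the vector of an index and `M` moves its operator, so `z` is central, hence a scalar, and
  -- it fixes the range of `p ≠ 0`. Thus `M p H` spans a dense subspace, on which `q` vanishes.
  obtain ⟨z, h1, h2, -, -, -, -, h5⟩ := exists_partialIsometry_commute (H := H) (ι := M × H)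
    (fun i => (i.1 : H →L[ℂ] H) (p i.2)) (fun i => (i.1 : H →L[ℂ] H) (p i.2)) (fun _ _ => rfl)
  have hz : z ∈ M := by
    refine M.mem_of_commute fun y hy => ?_
    have hc : ∀ y ∈ M.commutant, ∀ i : M × H, y ((i.1 : H →L[ℂ] H) (p i.2)) =
        (i.1 : H →L[ℂ] H) (p (y i.2)) := fun y hy i =>
      (congrArg (fun T : H →L[ℂ] H => T i.2) (M.commute_of_mem (mul_mem i.1.2 hp) hy)).symm
    exact h5 y (fun i => ⟨(i.1, y i.2), hc y hy i, hc y hy i⟩)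
      (fun i => ⟨(i.1, star y i.2), hc _ (star_mem hy) i⟩)
  have hz' : z ∈ M.commutant := by
    rw [mem_commutant_iff]
    exact fun y hy => h5 y (fun i => ⟨(⟨y, hy⟩ * i.1, i.2), rfl, rfl⟩)
      (fun i => ⟨(⟨star y, star_mem hy⟩ * i.1, i.2), rfl⟩)
  obtain ⟨c, hc⟩ := hM z hz hz'
  have hzp : ∀ ξ, z (p ξ) = p ξ := fun ξ => h1 (1, ξ)
  have hc1 : c = 1 := by
    obtain ⟨ξ, hξ⟩ : ∃ ξ, p ξ ≠ 0 := by
      by_contra! h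
      exact hp0 (ContinuousLinearMap.ext h)
    have h6 := hzp ξ
    rw [hc] at h6
    have h7 : (c - 1) • p ξ = 0 := by
      rw [sub_smul, one_smul, sub_eq_zero]; exact h6
    exact sub_eq_zero.1 ((smul_eq_zero.1 h7).resolve_right hξ)
  rw [hc1, one_smul] at hc
  apply hq0
  refine ContinuousLinearMap.ext_of_family (fun i : M × H => (i.1 : H →L[ℂ] H) (p i.2))
    (fun i => congrArg (fun T : H →L[ℂ] H => T i.2) (hcon i.1 i.1.2)) (fun ξ hξ => ?_)
  have := h2 ξ hξ
  rw [hc] at this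
  rw [show ξ = 0 from this, map_zero, map_zero]

/-- Comparison of projections in a factor. -/
theorem IsFactor.comparison {M : VonNeumannAlgebra H} (hM : M.IsFactor) {p q : H →L[ℂ] H}
    (hp : IsStarProjection p) (hpM : p ∈ M) (hq : IsStarProjection q) (hqM : q ∈ M) :
    (∃ v ∈ M, star v * v = p ∧ q * v = v) ∨ (∃ v ∈ M, star v * v = q ∧ p * v = v) := by
  -- Zorn's lemma is applied to sets of non-zero partial isometries from subprojections of `p` to
  -- subprojections of `q`, with pairwise orthogonal initial spaces and pairwise orthogonal ranges.
  let P : Set (Set (H →L[ℂ] H)) := {S | (∀ v ∈ S, v ∈ M ∧ v * star v * v = v ∧ v * p = v ∧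
    q * v = v ∧ v ≠ 0) ∧ S.Pairwise fun v w => star v * w = 0 ∧ v * star w = 0}
  obtain ⟨S, hS⟩ : ∃ S, Maximal (· ∈ P) S := by
    refine zorn_subset P fun c hcP hc => ⟨⋃₀ c, ⟨?_, ?_⟩, fun s hs => Set.subset_sUnion_of_mem hs⟩
    · rintro v ⟨s, hs, hv⟩
      exact (hcP hs).1 v hv
    · rw [Set.pairwise_sUnion hc.directedOn]
      exact fun s hs => (hcP hs).2
  obtain ⟨⟨hS1, hS2⟩, hmax⟩ := hS
  have hpa : ∀ v ∈ S, p * star v = star v := fun v hv => by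
    have := congrArg star (hS1 v hv).2.2.1
    rwa [star_mul, hp.isSelfAdjoint.star_eq] at this
  have hgram : ∀ i j : S × H, ⟪(star (i.1 : H →L[ℂ] H) * i.1) i.2,
      (star (j.1 : H →L[ℂ] H) * j.1) j.2⟫_ℂ =
      ⟪(i.1 : H →L[ℂ] H) i.2, (j.1 : H →L[ℂ] H) j.2⟫_ℂ := by
    rintro ⟨⟨v, hv⟩, ξ⟩ ⟨⟨w, hw⟩, η⟩
    show ⟪ContinuousLinearMap.adjoint v (v ξ), (star w * w) η⟫_ℂ = ⟪v ξ, w η⟫_ℂ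
    rw [ContinuousLinearMap.adjoint_inner_left]
    by_cases hvw : v = w
    · subst hvw
      exact congrArg (fun T : H →L[ℂ] H => ⟪v ξ, T η⟫_ℂ)
        ((mul_assoc v (star v) v).symm.trans (hS1 v hv).2.1)
    · have h := hS2 hv hw hvw
      rw [← ContinuousLinearMap.adjoint_inner_right v ξ (w η)]
      have h1 : v ((star w * w) η) = 0 :=
        congrArg (fun T : H →L[ℂ] H => T (w η)) h.2
      have h2 : ContinuousLinearMap.adjoint v (w η) = 0 :=
        congrArg (fun T : H →L[ℂ] H => T η) h.1
      rw [h1, h2, inner_zero_right, inner_zero_right]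
  -- `V` stands for the possibly infinite sum of the members of `S`: it sends `v* v ξ` to `v ξ` for
  -- each `v ∈ S` and kills the orthogonal complement of these vectors.
  obtain ⟨V, h1, h2, h3, h4, h5, h6, h7⟩ := exists_partialIsometry_commute
    (fun i : S × H => (star (i.1 : H →L[ℂ] H) * i.1) i.2)
    (fun i : S × H => (i.1 : H →L[ℂ] H) i.2) hgram
  have hVM : V ∈ M := by
    refine M.mem_of_commute fun y hy => ?_
    have hc : ∀ z ∈ M, ∀ y ∈ M.commutant, ∀ ξ, y (z ξ) = z (y ξ) := fun z hz y hy ξ =>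
      (congrArg (fun T : H →L[ℂ] H => T ξ) (M.commute_of_mem hz hy)).symm
    have hi : ∀ i : S × H, star (i.1 : H →L[ℂ] H) * i.1 ∈ M := fun i =>
      mul_mem (star_mem (hS1 _ i.1.2).1) (hS1 _ i.1.2).1
    exact h7 y (fun i => ⟨(i.1, y i.2), hc _ (hi i) y hy _, hc _ (hS1 _ i.1.2).1 y hy _⟩)
      (fun i => ⟨(i.1, star y i.2), hc _ (hi i) _ (star_mem hy) _⟩)
  have hVp : V * p = V := h5 p hp.isSelfAdjoint fun i =>
    congrArg (fun T : H →L[ℂ] H => T (i.1.1 i.2)) (hpa _ i.1.2)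
  have hqV : q * V = V := h6 q fun i =>
    congrArg (fun T : H →L[ℂ] H => T i.2) (hS1 _ i.1.2).2.2.2.1
  have hpV : p * star V = star V := by
    have := congrArg star hVp
    rwa [star_mul, hp.isSelfAdjoint.star_eq] at this
  have hVv : ∀ v ∈ S, V * (star v * v) = v := fun v hv => ContinuousLinearMap.ext fun ξ =>
    h1 (⟨v, hv⟩, ξ)
  have hVv' : ∀ v ∈ S, star V * v = star v * v := fun v hv => ContinuousLinearMap.ext fun ξ =>
    h3 (⟨v, hv⟩, ξ)
  by_cases he : star V * V = p
  · exact Or.inl ⟨V, hVM, he, hqV⟩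
  by_cases hf : V * star V = q
  · exact Or.inr ⟨star V, star_mem hVM, by rwa [star_star], hpV⟩
  exfalso
  have heproj : IsStarProjection (star V * V) :=
    ⟨by rw [IsIdempotentElem, mul_assoc, ← mul_assoc V, h4], IsSelfAdjoint.star_mul_self V⟩
  have hpe : IsStarProjection (p - star V * V) :=
    heproj.sub_of_mul_eq_left hp (by rw [mul_assoc, hVp])
  -- If `V` exhausts neither `p` nor `q`, the two remainders are linked by some `y ∈ M`. The polar
  -- part `u` of the linking element is orthogonal to all of `S` on both sides and could be added to
  -- `S`.
  obtain ⟨y, hy, hyne⟩ := hM.exists_mul_mul_ne_zero (p := p - star V * V) (q := q - V * star V)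
    (sub_mem hpM (mul_mem (star_mem hVM) hVM)) (sub_ne_zero.2 fun h => he h.symm)
    (sub_ne_zero.2 fun h => hf h.symm)
  have hxM : (q - V * star V) * y * (p - star V * V) ∈ M :=
    mul_mem (mul_mem (sub_mem hqM (mul_mem hVM (star_mem hVM))) hy)
      (sub_mem hpM (mul_mem (star_mem hVM) hVM))
  obtain ⟨u, huM, h, -, huh, hu1, hu2, hu3⟩ := M.exists_polar hxM
  have hu0 : u ≠ 0 := by
    rintro rfl
    rw [zero_mul] at huh
    exact hyne huh.symm
  have hue : u * (p - star V * V) = u := hu2 _ hpe (by rw [mul_assoc, hpe.isIdempotentElem])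
  have hqq : q * (q - V * star V) = q - V * star V := by
    rw [mul_sub, hq.isIdempotentElem, ← mul_assoc, hqV]
  have hpp : (p - star V * V) * p = p - star V * V := by
    rw [sub_mul, hp.isIdempotentElem, mul_assoc, hVp]
  have hfproj : (q - V * star V) * (q - V * star V) = q - V * star V := by
    have e1 : V * star V * q = V * star V := by
      have := congrArg star hqV
      rw [star_mul, hq.isSelfAdjoint.star_eq] at this
      rw [mul_assoc, this]
    have e2 : V * star V * (V * star V) = V * star V := by
      rw [← mul_assoc, h4]
    rw [mul_sub, sub_mul, sub_mul, hq.isIdempotentElem, e1, e2, ← mul_assoc, hqV]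
    abel
  have hfu : (q - V * star V) * u = u := hu3 _ (by rw [← mul_assoc, ← mul_assoc, hfproj])
  have hup : u * p = u := by rw [← hue, mul_assoc, hpp]
  have hqu : q * u = u := by rw [← hfu, ← mul_assoc, hqq]
  have hvV : ∀ v ∈ S, star v * V = star v * v := fun v hv => by
    have := congrArg star (hVv' v hv)
    rwa [star_mul, star_star, star_mul, star_star] at this
  have hvv : ∀ v ∈ S, star v * v * star v = star v := fun v hv => by
    have := congrArg star (hS1 v hv).2.1
    rwa [star_mul, star_mul, star_star, ← mul_assoc] at this
  have hvV' : ∀ v ∈ S, star v * v * star V = star v := fun v hv => by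
    have := congrArg star (hVv v hv)
    rwa [star_mul, star_mul, star_star] at this
  have hleft : ∀ v ∈ S, star v * u = 0 := fun v hv => by
    have e1 : star v * q = star v := by
      have := congrArg star (hS1 v hv).2.2.2.1
      rwa [star_mul, hq.isSelfAdjoint.star_eq] at this
    rw [← hfu, ← mul_assoc, mul_sub, ← mul_assoc, hvV v hv, hvV' v hv, e1, sub_self, zero_mul]
  have hright : ∀ v ∈ S, v * star u = 0 := fun v hv => by
    have e1 : (p - star V * V) * star u = star u := by
      have := congrArg star hue
      rwa [star_mul, hpe.isSelfAdjoint.star_eq] at this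
    have e2 : v * star V = v * star v := by
      conv_lhs => rw [← (hS1 v hv).2.1, mul_assoc v, mul_assoc v, hvV' v hv]
    have e3 : v * star v * V = v := by rw [mul_assoc, hvV v hv, ← mul_assoc, (hS1 v hv).2.1]
    rw [← e1, ← mul_assoc, mul_sub, (hS1 v hv).2.2.1, ← mul_assoc, e2, e3, sub_self, zero_mul]
  have huS : u ∈ S := by
    refine hmax (y := insert u S) ⟨?_, ?_⟩ (Set.subset_insert _ _) (Set.mem_insert _ _)
    · rintro v (rfl | hv)
      · exact ⟨huM, hu1, hup, hqu, hu0⟩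
      · exact hS1 v hv
    · rw [Set.pairwise_insert]
      refine ⟨hS2, fun v hv _ => ⟨⟨?_, ?_⟩, hleft v hv, hright v hv⟩⟩
      · simpa using congrArg star (hleft v hv)
      · simpa using congrArg star (hright v hv)
  -- Maximality has put `u` into `S`, so orthogonality to the members of `S` applies to `u` itself
  -- and gives `u* u = 0`.
  apply hu0
  rw [← hu1, mul_assoc, hleft u huS, mul_zero]

end VonNeumannAlgebra

/-! ### Faithful traces on *-rings with comparison agree on projections -/

section FaithfulTrace

variable {A : Type*} [Ring A] [StarRing A]

/-- A faithful real-valued tracial state on a *-ring. -/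
structure IsFaithfulTrace (t : A →+ ℝ) : Prop where
  nonneg : ∀ x, 0 ≤ t (star x * x)
  mul_comm : ∀ x y, t (x * y) = t (y * x)
  faithful : ∀ x, t (star x * x) = 0 → x = 0
  map_one : t 1 = 1

/-- Any two projections are comparable in the sense of Murray and von Neumann. -/
def HasComparison (A : Type*) [Ring A] [StarRing A] : Prop :=
  ∀ p q : A, IsStarProjection p → IsStarProjection q →
    (∃ v, star v * v = p ∧ q * v = v) ∨ (∃ v, star v * v = q ∧ p * v = v)

theorem IsStarProjection.star_mul_self {p : A} (hp : IsStarProjection p) : star p * p = p := by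
  rw [hp.isSelfAdjoint.star_eq, hp.isIdempotentElem]

theorem IsStarProjection.mul_eq_right_iff {p q : A} (hp : IsStarProjection p)
    (hq : IsStarProjection q) : p * q = q ↔ q * p = q := by
  constructor <;> intro h <;> have := congrArg star h <;>
  rwa [star_mul, hp.isSelfAdjoint.star_eq, hq.isSelfAdjoint.star_eq] at this

namespace IsFaithfulTrace

variable {t : A →+ ℝ} (ht : IsFaithfulTrace t)
include ht

theorem nonneg_of_proj {p : A} (hp : IsStarProjection p) : 0 ≤ t p := by
  rw [← hp.star_mul_self]; exact ht.nonneg p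

theorem pos_of_proj {p : A} (hp : IsStarProjection p) (hp0 : p ≠ 0) : 0 < t p := by
  refine lt_of_le_of_ne (ht.nonneg_of_proj hp) fun h => hp0 (ht.faithful p ?_)
  rw [hp.star_mul_self, ← h]

theorem le_of_proj {p q : A} (hp : IsStarProjection p) (hq : IsStarProjection q)
    (h : p * q = q) : t q ≤ t p := by
  have := ht.nonneg_of_proj (hq.sub_of_mul_eq_right hp h)
  rw [map_sub] at this
  linarith

theorem le_one {p : A} (hp : IsStarProjection p) : t p ≤ 1 := by
  rw [← ht.map_one]; exact ht.le_of_proj (.one A) hp (one_mul p)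

/-- In a bare *-ring the faithful trace does the work of the C*-identity: `(vp - v)* (vp - v) = 0`
forces `vp = v`. -/
theorem mul_right_of_star_mul_self {v p : A} (hp : IsStarProjection p) (hv : star v * v = p) :
    v * p = v := by
  have h : star (v * p - v) * (v * p - v) = 0 := by
    rw [star_sub, star_mul, hp.isSelfAdjoint.star_eq, mul_sub, sub_mul, sub_mul]
    simp only [← mul_assoc]
    rw [mul_assoc p, hv, hp.isIdempotentElem, hp.isIdempotentElem]
    abel
  exact sub_eq_zero.1 (ht.faithful _ (by rw [h, map_zero]))

theorem isStarProjection_mul_star_self {v p : A} (hp : IsStarProjection p)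
    (hv : star v * v = p) : IsStarProjection (v * star v) :=
  ⟨by rw [IsIdempotentElem, ← mul_assoc, mul_assoc v, hv, ht.mul_right_of_star_mul_self hp hv],
    IsSelfAdjoint.mul_star_self v⟩

/-- Division of a projection by a non-zero projection `e`, with remainder. -/
theorem exists_division (hA : HasComparison A) {e : A} (he : IsStarProjection e) (he0 : e ≠ 0)
    {p : A} (hp : IsStarProjection p) :
    ∃ (n : ℕ) (v : ℕ → A), ∑ i ∈ Finset.range (n + 1), v i * star (v i) = p ∧
      (∀ i, v i * e = v i) ∧ (∀ i < n, star (v i) * v i = e) ∧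
      IsStarProjection (star (v n) * v n) := by
  have hpos := ht.pos_of_proj he he0
  -- The bound `t p < k * t e` limits how many disjoint copies of `e` fit under `p`; splitting off
  -- one copy lowers `k` by one.
  obtain ⟨k, hk⟩ := exists_nat_gt (t p / t e)
  rw [div_lt_iff₀ hpos] at hk
  induction k generalizing p with
  | zero =>
    have := ht.nonneg_of_proj hp
    norm_num at hk
    linarith
  | succ k ih =>
    rcases hA p e hp he with ⟨u, hu, heu⟩ | ⟨u, hu, hpu⟩
    · refine ⟨0, fun _ => star u, ?_, fun _ => ?_, by simp, ?_⟩
      · simp [hu]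
      · have := congrArg star heu
        rwa [star_mul, he.isSelfAdjoint.star_eq] at this
      · simpa using ht.isStarProjection_mul_star_self hp hu
    · have hp' : IsStarProjection (p - u * star u) :=
        (ht.isStarProjection_mul_star_self he hu).sub_of_mul_eq_right hp
          (by rw [← mul_assoc, hpu])
      have htp : t (p - u * star u) = t p - t e := by
        rw [map_sub, ht.mul_comm u, hu]
      obtain ⟨n, v, h1, h2, h3, h4⟩ := ih hp' (by
        rw [htp]; push_cast at hk; linarith)
      -- The new copy `u` becomes entry `0` and the earlier entries shift by one, so the remainder
      -- stays in last place.
      refine ⟨n + 1, fun i => Nat.casesOn i u v, ?_, ?_, ?_, h4⟩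
      · rw [Finset.sum_range_succ']
        show ∑ i ∈ Finset.range (n + 1), v i * star (v i) + u * star u = p
        rw [h1]; abel
      · rintro (_ | i)
        · exact ht.mul_right_of_star_mul_self he hu
        · exact h2 i
      · rintro (_ | i) hi
        · exact hu
        · exact h3 i (by omega)

omit ht in
/-- The traces of a projection and of a divisor of it. -/
theorem exists_division_trace (ht : IsFaithfulTrace t) {s : A →+ ℝ} (hs : IsFaithfulTrace s)
    (hA : HasComparison A) {e : A} (he : IsStarProjection e) (he0 : e ≠ 0)
    {p : A} (hp : IsStarProjection p) :
    ∃ (n : ℕ) (r : A), IsStarProjection r ∧ e * r = r ∧ t p = n * t e + t r ∧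
      s p = n * s e + s r := by
  obtain ⟨n, v, h1, h2, h3, h4⟩ := ht.exists_division hA he he0 hp
  -- The division is purely algebraic, so the same count `n` and the same remainder serve every
  -- trace. This is how two traces are compared.
  have key : ∀ t : A →+ ℝ, IsFaithfulTrace t → t p = n * t e + t (star (v n) * v n) := by
    intro t ht
    rw [← h1, map_sum, Finset.sum_range_succ, ht.mul_comm (v n)]
    congr 1
    rw [Finset.sum_congr rfl (g := fun _ => t e), Finset.sum_const, Finset.card_range,
      nsmul_eq_mul]
    intro i hi
    rw [ht.mul_comm, h3 i (Finset.mem_range.1 hi)]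
  refine ⟨n, _, h4, ?_, key t ht, key s hs⟩
  rw [he.mul_eq_right_iff h4, mul_assoc, h2]

/-- If `e` is not minimal, it splits as `f + (e - f)` with both parts non-zero, and one of them has
at most half the trace of `e`. Without minimal projections the halving can be repeated indefinitely.
-/
theorem exists_small_or_minimal :
    (∀ n : ℕ, ∃ e : A, IsStarProjection e ∧ e ≠ 0 ∧ t e ≤ (1 / 2) ^ n) ∨
    ∃ e : A, IsStarProjection e ∧ e ≠ 0 ∧ ∀ f, IsStarProjection f → e * f = f → f = 0 ∨ f = e := by
  by_contra! h
  obtain ⟨⟨n, hn⟩, h2⟩ := h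
  have key : ∀ n : ℕ, ∃ e : A, IsStarProjection e ∧ e ≠ 0 ∧ t e ≤ (1 / 2) ^ n := by
    intro n
    induction n with
    | zero =>
      refine ⟨1, .one A, fun h => ?_, by simp [ht.map_one]⟩
      have := ht.map_one
      rw [h, map_zero] at this
      exact zero_ne_one this
    | succ n ih =>
      obtain ⟨e, he, he0, hle⟩ := ih
      obtain ⟨f, hf, hef, hf0, hfe⟩ := h2 e he he0
      have h3 : t (e - f) = t e - t f := map_sub _ _ _
      rw [pow_succ]
      by_cases hlt : t f ≤ t e / 2
      · exact ⟨f, hf, hf0, by linarith⟩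
      · exact ⟨e - f, hf.sub_of_mul_eq_right he hef, sub_ne_zero.2 hfe.symm, by linarith⟩
  obtain ⟨e, he, he0, hle⟩ := key n
  exact (hn e he he0).not_ge hle

-- Measure `p` and `1` by a projection `e`, which fits `n` times into `p` and `m` times into `1`.
-- When `t e` is small, this gives `t p ≤ (n + 1) / m` and `s p ≥ n / (m + 1)`, which differ by
-- little. When `e` is minimal, the remainders are `0` or `e`, so both traces of `p` are the same
-- exact quotient of integers.
omit ht in
theorem le_of_comparison (ht : IsFaithfulTrace t) {s : A →+ ℝ} (hs : IsFaithfulTrace s)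
    (hA : HasComparison A) {p : A} (hp : IsStarProjection p) : t p ≤ s p := by
  rcases ht.exists_small_or_minimal with hsmall | ⟨e, he, he0, hmin⟩
  · refine le_of_forall_pos_le_add fun ε hε => ?_
    -- The bound `1/4` forces `m ≥ 3`, whence `m + 1 ≤ 2m`; together with `ε/8` this gives `1/m ≤
    -- ε/4`. The final error is at most `2/m ≤ ε/2`.
    obtain ⟨N, hN⟩ := exists_pow_lt_of_lt_one (show (0 : ℝ) < min (ε / 8) (1 / 4) by positivity)
      (show (1 / 2 : ℝ) < 1 by norm_num)
    obtain ⟨e, he, he0, hle⟩ := hsmall N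
    have hte : t e < ε / 8 := lt_of_le_of_lt hle (hN.trans_le (min_le_left _ _))
    have hte' : t e < 1 / 4 := lt_of_le_of_lt hle (hN.trans_le (min_le_right _ _))
    obtain ⟨n, r, hr, her, h1, h2⟩ := ht.exists_division_trace hs hA he he0 hp
    obtain ⟨m, r', hr', her', h3, h4⟩ := ht.exists_division_trace hs hA he he0 (p := 1) (.one A)
    rw [ht.map_one] at h3
    rw [hs.map_one] at h4
    have a1 := ht.pos_of_proj he he0
    have a2 := hs.pos_of_proj he he0
    have b1 := ht.le_of_proj he hr her
    have b2 := ht.le_of_proj he hr' her'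
    have b3 := hs.le_of_proj he hr' her'
    have c1 := ht.nonneg_of_proj hr
    have c2 := hs.nonneg_of_proj hr
    have c3 := ht.nonneg_of_proj hr'
    have c4 := hs.nonneg_of_proj hr'
    have d1 := ht.le_one hp
    have hm : (1 : ℝ) ≤ (m + 1) * t e := by linarith
    have hm' : (m : ℝ) * s e ≤ 1 := by linarith
    have hms : (1 : ℝ) ≤ (m + 1) * s e := by linarith
    have hmt : (m : ℝ) * t e ≤ 1 := by linarith
    have hn1 : t p ≤ (n + 1) * t e := by linarith
    have hn2 : (n : ℝ) * s e ≤ s p := by linarith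
    have hnt : (n : ℝ) * t e ≤ 1 := by linarith
    have hm0 : (0 : ℝ) < m + 1 := by positivity
    have hn0 : (0 : ℝ) ≤ n := by positivity
    have hnm : (n : ℝ) ≤ m + 1 := by
      by_contra hcon
      push Not at hcon
      nlinarith
    have hse : s e ≥ 1 / (m + 1) := by rw [ge_iff_le, div_le_iff₀ hm0]; linarith
    have hm2 : (3 : ℝ) ≤ m := by
      by_contra hcon
      push Not at hcon
      nlinarith
    have hmpos : (0 : ℝ) < m := by linarith
    have hte2 : t e ≤ 1 / m := by rw [le_div_iff₀ hmpos]; linarith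
    have e1 : t p ≤ (n + 1) * (1 / m) := hn1.trans (by gcongr)
    have e2 : (n : ℝ) * (1 / (m + 1)) ≤ s p := le_trans (by gcongr) hn2
    have hme : 1 / (m : ℝ) ≤ ε / 4 := by
      rw [div_le_iff₀ hmpos]
      nlinarith
    have e3 : ((n : ℝ) + 1) * (1 / m) = n * (1 / (m + 1)) + (n / (m + 1) + 1) * (1 / m) := by
      field_simp
      ring
    have e4 : (n : ℝ) / (m + 1) ≤ 1 := by rw [div_le_one hm0]; exact hnm
    have e5 : ((n : ℝ) / (m + 1) + 1) * (1 / m) ≤ (1 + 1) * (ε / 4) := by gcongr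
    linarith
  · obtain ⟨n, r, hr, her, h1, h2⟩ := ht.exists_division_trace hs hA he he0 hp
    obtain ⟨m, r', hr', her', h3, h4⟩ := ht.exists_division_trace hs hA he he0 (p := 1) (.one A)
    have key : ∀ (n : ℕ) (r : A), IsStarProjection r → e * r = r → ∃ k : ℕ,
        n * t e + t r = k * t e ∧ n * s e + s r = k * s e := by
      intro n r hr her
      rcases hmin r hr her with rfl | rfl
      · exact ⟨n, by simp⟩
      · exact ⟨n + 1, by push_cast; constructor <;> ring⟩
    obtain ⟨k, hk1, hk2⟩ := key n r hr her
    obtain ⟨l, hl1, hl2⟩ := key m r' hr' her'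
    rw [hk1] at h1
    rw [hk2] at h2
    rw [hl1, ht.map_one] at h3
    rw [hl2, hs.map_one] at h4
    have hl : (l : ℝ) ≠ 0 := fun h => by rw [h, zero_mul] at h3; exact one_ne_zero h3
    have : t e = s e := mul_left_cancel₀ hl (h3.symm.trans h4)
    rw [h1, h2, this]

/-- All faithful traces agree on projections. -/
theorem eq_of_comparison {s : A →+ ℝ} (hs : IsFaithfulTrace s)
    (hA : HasComparison A) {p : A} (hp : IsStarProjection p) : t p = s p :=
  le_antisymm (ht.le_of_comparison hs hA hp) (hs.le_of_comparison ht hA hp)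

/-- A projection is equivalent to its image under an automorphism. -/
theorem exists_equiv_map (hA : HasComparison A) (θ : A ≃+* A) (hθ : ∀ x, θ (star x) = star (θ x))
    {p : A} (hp : IsStarProjection p) : ∃ w : A, w * star w = p ∧ star w * w = θ p := by
  -- The trace pulled back along `θ` is again a faithful trace, so it agrees with `t` on `p`.
  have hs : IsFaithfulTrace (t.comp θ.toAddEquiv.toAddMonoidHom) := by
    refine ⟨fun x => ?_, fun x y => ?_, fun x hx => ?_, ?_⟩
    · simpa [hθ] using ht.nonneg (θ x)
    · simpa using ht.mul_comm (θ x) (θ y)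
    · have : t (star (θ x) * θ x) = 0 := by simpa [hθ] using hx
      simpa using ht.faithful _ this
    · simpa using ht.map_one
  have htθ : t p = t (θ p) := ht.eq_of_comparison hs hA hp
  have hp' : IsStarProjection (θ p) := ⟨by
    rw [IsIdempotentElem, ← map_mul, hp.isIdempotentElem], by
    rw [IsSelfAdjoint, ← hθ, hp.isSelfAdjoint.star_eq]⟩
  -- A partial isometry from `p` into `q` is onto when the traces are equal, because the defect `q -
  -- v v*` is a projection of trace zero.
  have key : ∀ p q v : A, IsStarProjection p → IsStarProjection q → t p = t q → star v * v = p →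
      q * v = v → v * star v = q := by
    intro p q v hp hq hpq h1 h2
    have h4 : IsStarProjection (q - v * star v) :=
      (ht.isStarProjection_mul_star_self hp h1).sub_of_mul_eq_right hq (by rw [← mul_assoc, h2])
    by_contra hne
    have := ht.pos_of_proj h4 (sub_ne_zero.2 fun h => hne h.symm)
    rw [map_sub, ht.mul_comm v, h1, hpq, sub_self] at this
    exact lt_irrefl _ this
  rcases hA p (θ p) hp hp' with ⟨v, h1, h2⟩ | ⟨v, h1, h2⟩
  · exact ⟨star v, by rw [star_star, h1], by rw [star_star]; exact key _ _ v hp hp' htθ h1 h2⟩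
  · exact ⟨v, key _ _ v hp' hp htθ.symm h1 h2, h1⟩

end IsFaithfulTrace

end FaithfulTrace

/-! ### Factors and their traces as instances of the abstract setting -/

namespace VonNeumannAlgebra

variable {H : Type u} [NormedAddCommGroup H] [InnerProductSpace ℂ H] [CompleteSpace H]

theorem IsFactor.hasComparison {M : VonNeumannAlgebra H} (hM : M.IsFactor) : HasComparison M := by
  intro p q hp hq
  have h : ∀ p : M, IsStarProjection p → IsStarProjection (p : H →L[ℂ] H) := fun p hp =>
    ⟨congrArg Subtype.val hp.isIdempotentElem, congrArg Subtype.val hp.isSelfAdjoint⟩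
  rcases hM.comparison (h p hp) p.2 (h q hq) q.2 with ⟨v, hv, h1, h2⟩ | ⟨v, hv, h1, h2⟩
  · exact Or.inl ⟨⟨v, hv⟩, Subtype.ext h1, Subtype.ext h2⟩
  · exact Or.inr ⟨⟨v, hv⟩, Subtype.ext h1, Subtype.ext h2⟩

/-- The real part of a trace. -/
def TraceState.re {M : VonNeumannAlgebra H} (τ : M.TraceState) : M →+ ℝ :=
  Complex.reAddGroupHom.comp τ.toPositiveLinearMap.toLinearMap.toAddMonoidHom

theorem TraceState.isFaithfulTrace_re {M : VonNeumannAlgebra H} (τ : M.TraceState) :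
    IsFaithfulTrace τ.re where
  nonneg x := (Complex.nonneg_iff.1 (τ.toPositiveLinearMap.map_nonneg (star_mul_self_nonneg x))).1
  mul_comm x y := congrArg Complex.re (τ.map_mul_comm x y)
  faithful x hx := by
    refine τ.faithful x (Complex.ext hx ?_)
    exact (Complex.nonneg_iff.1 (τ.toPositiveLinearMap.map_nonneg (star_mul_self_nonneg x))).2.symm
  map_one := (congrArg Complex.re τ.map_one).trans Complex.one_re

end VonNeumannAlgebra

/-! ### Algebra of the perturbed action and its 2-cocycle -/

section PerturbedAction

variable {A : Type*} [Ring A] [StarRing A] [Algebra ℂ A] {G : Type*} [Group G]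

/-- Partial isometries `w_g` from `α_g(p)` onto `p`, with `w_1 = p`. -/
structure IsTransport (α : G →* (A ≃⋆ₐ[ℂ] A)) (p : A) (w : G → A) : Prop where
  proj : IsStarProjection p
  one : w 1 = p
  mul_star_self : ∀ g, w g * star (w g) = p
  star_mul_self : ∀ g, star (w g) * w g = α g p
  proj_mul : ∀ g, p * w g = w g
  mul_proj : ∀ g, w g * α g p = w g

theorem IsFaithfulTrace.exists_isTransport {t : A →+ ℝ} (ht : IsFaithfulTrace t)
    (hA : HasComparison A) (α : G →* (A ≃⋆ₐ[ℂ] A)) {p : A} (hp : IsStarProjection p) :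
    ∃ w : G → A, IsTransport α p w := by
  classical
  -- The value at `g = 1` is prescribed, since `w_1 = p` is what normalizes both the action and the
  -- cocycle.
  have h : ∀ g, ∃ w : A, w * star w = p ∧ star w * w = α g p ∧ (g = 1 → w = p) := by
    intro g
    by_cases hg : g = 1
    · subst hg
      exact ⟨p, by rw [hp.isSelfAdjoint.star_eq, hp.isIdempotentElem],
        by rw [hp.star_mul_self, _root_.map_one α]; rfl, fun _ => rfl⟩
    · obtain ⟨w, h1, h2⟩ := ht.exists_equiv_map hA (α g : A ≃+* A) (fun x => map_star (α g) x) hp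
      exact ⟨w, h1, h2, fun h => absurd h hg⟩
  choose w h1 h2 h3 using h
  refine ⟨w, hp, h3 1 rfl, h1, h2, fun g => ?_, fun g => ?_⟩
  · have := ht.mul_right_of_star_mul_self hp (v := star (w g)) (by rw [star_star, h1])
    have := congrArg star this
    rwa [star_mul, star_star, hp.isSelfAdjoint.star_eq] at this
  · exact ht.mul_right_of_star_mul_self (hp.map (α g)) (h2 g)

namespace IsTransport

variable {α : G →* (A ≃⋆ₐ[ℂ] A)} {p : A} {w : G → A} (hw : IsTransport α p w)

omit [Algebra ℂ A] in
theorem _root_.mul_eq_of_corner {p x : A} (hp : IsStarProjection p) (hx : p * x * p = x) :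
    p * x = x ∧ x * p = x := by
  constructor
  · rw [← hx, ← mul_assoc, ← mul_assoc, hp.isIdempotentElem]
  · rw [← hx, mul_assoc, hp.isIdempotentElem]

theorem map_map (α : G →* (A ≃⋆ₐ[ℂ] A)) (g h : G) (x : A) : α g (α h x) = α (g * h) x := by
  rw [map_mul α]; rfl

include hw

theorem proj_mul_star (g : G) : α g p * star (w g) = star (w g) := by
  have := congrArg star (hw.mul_proj g)
  rwa [star_mul, ← map_star, hw.proj.isSelfAdjoint.star_eq] at this

theorem star_mul_proj (g : G) : star (w g) * p = star (w g) := by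
  have := congrArg star (hw.proj_mul g)
  rwa [star_mul, hw.proj.isSelfAdjoint.star_eq] at this

theorem conj_mem (g : G) (x : A) :
    p * (w g * α g x * star (w g)) * p = w g * α g x * star (w g) := by
  rw [← mul_assoc, ← mul_assoc, hw.proj_mul, mul_assoc, hw.star_mul_proj]

theorem conj_symm_mem (g : G) (x : A) :
    p * ((α g).symm (star (w g) * x * w g)) * p = (α g).symm (star (w g) * x * w g) := by
  apply EquivLike.injective (α g)
  rw [map_mul, map_mul, StarAlgEquiv.apply_symm_apply, ← mul_assoc, ← mul_assoc,
    hw.proj_mul_star, mul_assoc, hw.mul_proj]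

theorem star_conj (g : G) {x : A} (hx : p * x * p = x) :
    star (w g) * (w g * α g x * star (w g)) * w g = α g x := by
  calc star (w g) * (w g * α g x * star (w g)) * w g
      = (star (w g) * w g) * α g x * (star (w g) * w g) := by simp only [mul_assoc]
    _ = α g x := by rw [hw.star_mul_self, ← map_mul, ← map_mul, hx]

theorem conj_symm_conj (g : G) {x : A} (hx : p * x * p = x) :
    (α g).symm (star (w g) * (w g * α g x * star (w g)) * w g) = x := by
  rw [hw.star_conj g hx, StarAlgEquiv.symm_apply_apply]

theorem conj_conj_symm (g : G) {x : A} (hx : p * x * p = x) :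
    w g * α g ((α g).symm (star (w g) * x * w g)) * star (w g) = x := by
  rw [StarAlgEquiv.apply_symm_apply]
  calc w g * (star (w g) * x * w g) * star (w g)
      = (w g * star (w g)) * x * (w g * star (w g)) := by simp only [mul_assoc]
    _ = x := by rw [hw.mul_star_self, hx]

theorem conj_mul (g : G) {x y : A} (hx : p * x * p = x) :
    w g * α g (x * y) * star (w g) =
      w g * α g x * star (w g) * (w g * α g y * star (w g)) := by
  calc w g * α g (x * y) * star (w g) = w g * (α g x * α g p) * α g y * star (w g) := by
        rw [← map_mul, (mul_eq_of_corner hw.proj hx).2, map_mul, ← mul_assoc]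
    _ = _ := by rw [← hw.star_mul_self]; simp only [mul_assoc]

/-- The 2-cocycle of the perturbed action. -/
theorem cocycle_mul_star (g h : G) : w g * α g (w h) * star (w (g * h)) *
    star (w g * α g (w h) * star (w (g * h))) = p := by
  calc _ = w g * (α g (w h) * (star (w (g * h)) * w (g * h)) * star (α g (w h))) * star (w g) := by
        simp only [star_mul, star_star, mul_assoc]
    _ = w g * α g (w h * α h p * star (w h)) * star (w g) := by
        rw [hw.star_mul_self, ← map_map, map_mul, map_mul, map_star]
    _ = p := by rw [hw.mul_proj, hw.mul_star_self, hw.mul_proj, hw.mul_star_self]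

theorem cocycle_star_mul (g h : G) : star (w g * α g (w h) * star (w (g * h))) *
    (w g * α g (w h) * star (w (g * h))) = p := by
  calc _ = w (g * h) * (star (α g (w h)) * (star (w g) * w g) * α g (w h)) * star (w (g * h)) := by
        simp only [star_mul, star_star, mul_assoc]
    _ = w (g * h) * α g (star (w h) * p * w h) * star (w (g * h)) := by
        rw [hw.star_mul_self, map_mul, map_mul, map_star]
    _ = p := by rw [hw.star_mul_proj, hw.star_mul_self, map_map, hw.mul_proj, hw.mul_star_self]

theorem cocycle_corner (g h : G) : p * (w g * α g (w h) * star (w (g * h))) * p =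
    w g * α g (w h) * star (w (g * h)) := by
  rw [← mul_assoc, ← mul_assoc, hw.proj_mul, mul_assoc, hw.star_mul_proj]

theorem act_act (g h : G) {x : A} (hx : p * x * p = x) :
    w g * α g (w h * α h x * star (w h)) * star (w g) =
      w g * α g (w h) * star (w (g * h)) * (w (g * h) * α (g * h) x * star (w (g * h))) *
        star (w g * α g (w h) * star (w (g * h))) := by
  have h1 : star (w (g * h)) * w (g * h) * α (g * h) x * (star (w (g * h)) * w (g * h)) =
      α (g * h) x := by rw [hw.star_mul_self, ← map_mul, ← map_mul, hx]
  calc _ = w g * α g (w h) * (star (w (g * h)) * w (g * h) * α (g * h) x *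
        (star (w (g * h)) * w (g * h))) * star (α g (w h)) * star (w g) := by
        rw [h1, map_mul, map_mul, map_star, map_map]; simp only [mul_assoc]
    _ = _ := by simp only [star_mul, star_star, mul_assoc]

/-- Both sides equal `w_g α_g(w_h) α_{gh}(w_k) w_{ghk}*`: the inner products `w* w` are values of
the action at `p` and are absorbed by their neighbours. -/
theorem cocycle_rel (g h k : G) :
    w g * α g (w h) * star (w (g * h)) *
        (w (g * h) * α (g * h) (w k) * star (w (g * h * k))) =
      w g * α g (w h * α h (w k) * star (w (h * k))) * star (w g) *
        (w g * α g (w (h * k)) * star (w (g * (h * k)))) := by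
  calc _ = w g * α g (w h) * (star (w (g * h)) * w (g * h) * α (g * h) (w k)) *
        star (w (g * h * k)) := by simp only [mul_assoc]
    _ = w g * α g (w h) * α (g * h) (w k) * star (w (g * h * k)) := by
        rw [hw.star_mul_self, ← map_mul, hw.proj_mul]
    _ = w g * α g (w h * α h (w k * α k p)) * star (w (g * h * k)) := by
        rw [hw.mul_proj, map_mul (α g), map_map]; simp only [mul_assoc]
    _ = w g * α g (w h * α h (w k) * (star (w (h * k)) * p * w (h * k))) *
        star (w (g * h * k)) := by
        rw [hw.star_mul_proj, hw.star_mul_self, ← map_map α h k, map_mul (α h)]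
        simp only [mul_assoc]
    _ = w g * α g (w h * α h (w k) * star (w (h * k))) * α g p * α g (w (h * k)) *
        star (w (g * h * k)) := by
        simp only [map_mul, mul_assoc]
    _ = _ := by rw [← hw.star_mul_self, mul_assoc g h k]; simp only [mul_assoc]

theorem cocycle_one_right (g : G) : w g * α g (w 1) * star (w (g * 1)) = p := by
  rw [hw.one, mul_one, hw.mul_proj, hw.mul_star_self]

theorem cocycle_one_left (g : G) : w 1 * α 1 (w g) * star (w (1 * g)) = p := by
  rw [hw.one, one_mul, map_one]
  show p * w g * star (w g) = p
  rw [hw.proj_mul, hw.mul_star_self]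

/-- This is the fibrewise computation of the range projection of `cornerIsometry`. -/
theorem symm_conj_proj (h : G) :
    (α h).symm (w h) * p * (α h).symm (star (w h)) = (α h).symm p := by
  apply EquivLike.injective (α h)
  simp only [map_mul (α h), StarAlgEquiv.apply_symm_apply, hw.mul_proj, hw.mul_star_self]

-- The factors `(α h).symm 1` are what the trivial cocycle contributes to `implementing`; with them
-- in place the identity is the fibre over `h` of `u_g x = α_g(x) u_g`.
omit hw in
theorem symm_act_comm (g h : G) (x : A) :
    (α h).symm 1 * (α (g⁻¹ * h)).symm x = (α h).symm (α g x) * (α h).symm 1 := by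
  obtain ⟨k, rfl⟩ : ∃ k, h = g * k := ⟨g⁻¹ * h, by simp⟩
  apply EquivLike.injective (α (g * k))
  simp only [inv_mul_cancel_left, map_mul (α (g * k)), StarAlgEquiv.apply_symm_apply, one_mul,
    mul_one]
  rw [← map_map, StarAlgEquiv.apply_symm_apply]

/-- The fibre over `h` of the relation `w_g u_g J = J u_g`, with the implementing unitary of the
perturbed action on the right. Both sides are `α_h⁻¹(w_g α_g(w_{g⁻¹h}))`, after `w_h w_h* = p` and
`w_h* w_h = α_h(p)` are absorbed. -/
theorem symm_cocycle (g h : G) :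
    (α h).symm (w g) * ((α h).symm 1 * (α (g⁻¹ * h)).symm (w (g⁻¹ * h))) =
      (α h).symm (w h) * (α h).symm
        (star (w h) * (w g * α g (w (g⁻¹ * h)) * star (w (g * (g⁻¹ * h)))) * w h) := by
  rw [symm_act_comm, ← map_mul, ← map_mul, ← map_mul]
  congr 1
  obtain ⟨k, rfl⟩ : ∃ k, h = g * k := ⟨g⁻¹ * h, by simp⟩
  rw [inv_mul_cancel_left, mul_one]
  calc w g * α g (w k) = w g * α g (w k * α k p) := by rw [hw.mul_proj]
    _ = w g * α g (w k) * (star (w (g * k)) * w (g * k)) := by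
        rw [hw.star_mul_self, ← map_map α g k, map_mul (α g), mul_assoc]
    _ = p * w g * α g (w k) * star (w (g * k)) * w (g * k) := by
        rw [hw.proj_mul, mul_assoc (w g * _)]
    _ = _ := by rw [← hw.mul_star_self (g * k)]; simp only [mul_assoc]

/-- An automorphism is inner as soon as it is implemented on a full corner. -/
theorem exists_unitary_of_corner {ι : Type*} (s : Finset ι) (r : ι → A)
    (hr : ∀ i ∈ s, r i * p = r i) (hsum : ∑ i ∈ s, r i * star (r i) = 1) (g : G) {u : A}
    (hu : u * star u = p) (hu' : star u * u = p)
    (h : ∀ x, p * x * p = x → w g * α g x * star (w g) = u * x * star u) :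
    ∃ U : unitary A, ∀ x, α g x = U * x * star (U : A) := by
  -- Removing `w_g` from the perturbed automorphism leaves `v x v* = α_g(x)` for `x` in the corner,
  -- with `v* v = p`.
  set v := star (w g) * u with hv
  have hvv : star v * v = p := by
    rw [hv, star_mul, star_star, mul_assoc, ← mul_assoc (w g), hw.mul_star_self, ← hu,
      ← mul_assoc, ← mul_assoc, hu', mul_assoc, hu', hw.proj.isIdempotentElem, hu]
  have hconj : ∀ x, p * x * p = x → v * x * star v = α g x := by
    intro x hx
    have h1 := h x hx
    calc v * x * star v = star (w g) * (u * x * star u) * w g := by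
          rw [hv, star_mul, star_star]; simp only [mul_assoc]
      _ = α g x := by
          rw [← h1, hw.star_conj g hx]
  have hcorner : ∀ i ∈ s, ∀ j ∈ s, ∀ y, p * (star (r i) * y * r j) * p = star (r i) * y * r j := by
    intro i hi j hj y
    have h1 : p * star (r i) = star (r i) := by
      have := congrArg star (hr i hi)
      rwa [star_mul, hw.proj.isSelfAdjoint.star_eq] at this
    rw [← mul_assoc, ← mul_assoc, h1, mul_assoc, hr j hj]
  have hconj' : ∀ x, p * x * p = x → star v * α g x * v = x := by
    intro x hx
    rw [← hconj x hx]
    calc star v * (v * x * star v) * v = star v * v * x * (star v * v) := by simp only [mul_assoc]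
      _ = x := by rw [hvv, hx]
  -- Write `x = ∑ r_i (r_i* x r_j) r_j*` with the middle factors in the corner. The sum `U` applies
  -- `v` to these factors and `α_g` to the outer ones, so `U x U* = α_g(x)`.
  set U := ∑ i ∈ s, α g (r i) * v * star (r i) with hU
  have hUs : star U = ∑ i ∈ s, r i * star v * star (α g (r i)) := by
    rw [hU, star_sum]
    exact Finset.sum_congr rfl fun i _ => by
      simp only [star_mul, star_star, mul_assoc]
  have key : ∀ x, U * x * star U = α g x := by
    intro x
    rw [hUs, hU, Finset.sum_mul, Finset.sum_mul_sum]
    calc _ = ∑ i ∈ s, ∑ j ∈ s, α g (r i * star (r i)) * α g x * α g (r j * star (r j)) := by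
          refine Finset.sum_congr rfl fun i hi => Finset.sum_congr rfl fun j hj => ?_
          calc _ = α g (r i) * (v * (star (r i) * x * r j) * star v) * star (α g (r j)) := by
                simp only [mul_assoc]
            _ = _ := by
                rw [hconj _ (hcorner i hi j hj x)]
                simp only [map_mul, map_star, mul_assoc]
      _ = α g x := by
          simp_rw [← Finset.mul_sum, ← Finset.sum_mul, ← map_sum, hsum, map_one, one_mul, mul_one]
  have hUU : U * star U = 1 := by simpa using key 1
  have hUU' : star U * U = 1 := by
    rw [hUs, hU, Finset.sum_mul_sum]
    calc _ = ∑ i ∈ s, ∑ j ∈ s, r i * star (r i) * (r j * star (r j)) := by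
          refine Finset.sum_congr rfl fun i hi => Finset.sum_congr rfl fun j hj => ?_
          calc _ = r i * (star v * α g (star (r i) * 1 * r j) * v) * star (r j) := by
                simp only [map_mul, map_star, mul_one, mul_assoc]
            _ = _ := by
                rw [hconj' _ (hcorner i hi j hj 1)]
                simp only [mul_one, mul_assoc]
      _ = 1 := by
          simp_rw [← Finset.mul_sum, ← Finset.sum_mul, hsum, mul_one]
  exact ⟨⟨U, Unitary.mem_iff.2 ⟨hUU', hUU⟩⟩, fun x => (key x).symm⟩

end IsTransport

end PerturbedAction

/-! ### The cocycle action on the corner `pMp` -/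

namespace VonNeumannAlgebra

variable {H : Type u} [NormedAddCommGroup H] [InnerProductSpace ℂ H] [CompleteSpace H]
  (M : VonNeumannAlgebra H) (p : H →L[ℂ] H) (hp : IsStarProjection p) (hpM : p ∈ M)

include hp in
theorem isStarProjection_mk : IsStarProjection (⟨p, hpM⟩ : M) :=
  ⟨Subtype.ext hp.isIdempotentElem, Subtype.ext hp.isSelfAdjoint⟩

/-- Operators of the corner live on the smaller space `pH`. By injectivity their identities can be
checked in `M`, where the calculus of `IsTransport` applies. -/
theorem cornerInclusion_injective : Function.Injective (M.cornerInclusion p hp hpM) := by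
  intro S T h
  exact Subtype.ext (cornerExtend_injective p (congrArg Subtype.val h))

/-- The compression of an operator to `pH`. -/
def _root_.cornerCompress (x : H →L[ℂ] H) : cornerSpace p →L[ℂ] cornerSpace p :=
  (cornerSpace p).orthogonalProjectionOnto ∘L x ∘L (cornerSpace p).subtypeL

include hp in
theorem _root_.cornerExtend_cornerCompress (x : H →L[ℂ] H) :
    cornerExtend p (cornerCompress p x) = p * x * p := by
  show (cornerSpace p).starProjection * x * (cornerSpace p).starProjection = _
  rw [starProjection_cornerSpace hp]

theorem exists_cornerInclusion_eq {x : M} (hx : ⟨p, hpM⟩ * x * ⟨p, hpM⟩ = x) :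
    ∃ T, M.cornerInclusion p hp hpM T = x := by
  have h : cornerExtend p (cornerCompress p x) = x :=
    (cornerExtend_cornerCompress p hp x).trans (congrArg Subtype.val hx)
  exact ⟨⟨cornerCompress p x, by rw [mem_corner, h]; exact x.2⟩, Subtype.ext h⟩

/-- The element of the corner given by an element `x` of `M` with `pxp = x`. -/
def toCorner (x : M) (hx : ⟨p, hpM⟩ * x * ⟨p, hpM⟩ = x) : M.corner p hp hpM :=
  (M.exists_cornerInclusion_eq p hp hpM hx).choose

theorem cornerInclusion_toCorner (x : M) (hx : ⟨p, hpM⟩ * x * ⟨p, hpM⟩ = x) :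
    M.cornerInclusion p hp hpM (M.toCorner p hp hpM x hx) = x :=
  (M.exists_cornerInclusion_eq p hp hpM hx).choose_spec

theorem corner_cornerInclusion (T : M.corner p hp hpM) :
    ⟨p, hpM⟩ * M.cornerInclusion p hp hpM T * ⟨p, hpM⟩ = M.cornerInclusion p hp hpM T := by
  rw [← M.cornerInclusion_one p hp hpM, ← cornerInclusion_mul, ← cornerInclusion_mul, one_mul,
    mul_one]

section Perturbation

variable {M p hpM} {G : Type v} [Group G] {α : G →* (M ≃⋆ₐ[ℂ] M)} {w : G → M}
  (hw : IsTransport α (⟨p, hpM⟩ : M) w)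
include hw

/-- The map `x ↦ w_g α_g(x) w_g*` on the corner. -/
def cornerConj (g : G) (T : M.corner p hp hpM) : M.corner p hp hpM :=
  M.toCorner p hp hpM _ (hw.conj_mem g (M.cornerInclusion p hp hpM T))

theorem cornerInclusion_cornerConj (g : G) (T : M.corner p hp hpM) :
    M.cornerInclusion p hp hpM (cornerConj hp hw g T) =
      w g * α g (M.cornerInclusion p hp hpM T) * star (w g) :=
  M.cornerInclusion_toCorner p hp hpM _ (hw.conj_mem g _)

/-- The map `x ↦ α_g⁻¹(w_g* x w_g)` on the corner. -/
def cornerConjSymm (g : G) (T : M.corner p hp hpM) : M.corner p hp hpM :=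
  M.toCorner p hp hpM _ (hw.conj_symm_mem g (M.cornerInclusion p hp hpM T))

theorem cornerInclusion_cornerConjSymm (g : G) (T : M.corner p hp hpM) :
    M.cornerInclusion p hp hpM (cornerConjSymm hp hw g T) =
      (α g).symm (star (w g) * M.cornerInclusion p hp hpM T * w g) :=
  M.cornerInclusion_toCorner p hp hpM _ (hw.conj_symm_mem g _)

/-- The automorphism `x ↦ w_g α_g(x) w_g*` of the corner. -/
def cornerAct (g : G) : M.corner p hp hpM ≃⋆ₐ[ℂ] M.corner p hp hpM where
  toFun := cornerConj hp hw g
  invFun := cornerConjSymm hp hw g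
  left_inv T := M.cornerInclusion_injective p hp hpM (by
    rw [cornerInclusion_cornerConjSymm, cornerInclusion_cornerConj,
      hw.conj_symm_conj g (M.corner_cornerInclusion p hp hpM T)])
  right_inv T := M.cornerInclusion_injective p hp hpM (by
    rw [cornerInclusion_cornerConj, cornerInclusion_cornerConjSymm,
      hw.conj_conj_symm g (M.corner_cornerInclusion p hp hpM T)])
  map_mul' S T := M.cornerInclusion_injective p hp hpM (by
    rw [cornerInclusion_mul, cornerInclusion_cornerConj, cornerInclusion_cornerConj,
      cornerInclusion_cornerConj, cornerInclusion_mul,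
      hw.conj_mul g (M.corner_cornerInclusion p hp hpM S)])
  map_add' S T := M.cornerInclusion_injective p hp hpM (by
    rw [map_add, cornerInclusion_cornerConj, cornerInclusion_cornerConj,
      cornerInclusion_cornerConj, map_add, map_add, mul_add, add_mul])
  map_star' T := M.cornerInclusion_injective p hp hpM (by
    rw [cornerInclusion_star, cornerInclusion_cornerConj, cornerInclusion_cornerConj,
      cornerInclusion_star, map_star, star_mul, star_mul, star_star, mul_assoc])
  map_smul' c T := M.cornerInclusion_injective p hp hpM (by
    rw [map_smul, cornerInclusion_cornerConj, cornerInclusion_cornerConj, map_smul, map_smul,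
      mul_smul_comm, smul_mul_assoc])

theorem cornerInclusion_cornerAct (g : G) (T : M.corner p hp hpM) :
    M.cornerInclusion p hp hpM (cornerAct hp hw g T) =
      w g * α g (M.cornerInclusion p hp hpM T) * star (w g) :=
  cornerInclusion_cornerConj hp hw g T

theorem cornerInclusion_cornerAct_symm (g : G) (T : M.corner p hp hpM) :
    M.cornerInclusion p hp hpM ((cornerAct hp hw g).symm T) =
      (α g).symm (star (w g) * M.cornerInclusion p hp hpM T * w g) :=
  cornerInclusion_cornerConjSymm hp hw g T

/-- The 2-cocycle `w_g α_g(w_h) w_{gh}*`. -/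
def cornerCocycle (g h : G) : unitary (M.corner p hp hpM) :=
  ⟨M.toCorner p hp hpM _ (hw.cocycle_corner g h), Unitary.mem_iff.2 ⟨by
    apply M.cornerInclusion_injective p hp hpM
    rw [cornerInclusion_mul, cornerInclusion_star, cornerInclusion_toCorner,
      hw.cocycle_star_mul, cornerInclusion_one], by
    apply M.cornerInclusion_injective p hp hpM
    rw [cornerInclusion_mul, cornerInclusion_star, cornerInclusion_toCorner,
      hw.cocycle_mul_star, cornerInclusion_one]⟩⟩

theorem cornerInclusion_cornerCocycle (g h : G) :
    M.cornerInclusion p hp hpM (cornerCocycle hp hw g h : M.corner p hp hpM) =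
      w g * α g (w h) * star (w (g * h)) :=
  M.cornerInclusion_toCorner p hp hpM _ (hw.cocycle_corner g h)

/-- The cocycle action on the corner `pMp` obtained from an action on `M` and partial isometries
`w_g ∈ M` from `α_g(p)` onto `p`. -/
def cornerCocycleAction : CocycleAction G (M.corner p hp hpM) where
  act := cornerAct hp hw
  cocycle := cornerCocycle hp hw
  act_one := by
    ext T : 1
    apply M.cornerInclusion_injective p hp hpM
    rw [cornerInclusion_cornerAct, hw.one, map_one, hw.proj.isSelfAdjoint.star_eq]
    exact M.corner_cornerInclusion p hp hpM T
  act_act g h T := by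
    apply M.cornerInclusion_injective p hp hpM
    simp only [cornerInclusion_mul, cornerInclusion_star, cornerInclusion_cornerAct,
      cornerInclusion_cornerCocycle]
    exact hw.act_act g h (M.corner_cornerInclusion p hp hpM T)
  cocycle_rel g h k := by
    apply M.cornerInclusion_injective p hp hpM
    simp only [cornerInclusion_mul, cornerInclusion_cornerAct, cornerInclusion_cornerCocycle]
    exact hw.cocycle_rel g h k
  cocycle_one_right g := by
    apply Subtype.ext
    apply M.cornerInclusion_injective p hp hpM
    rw [cornerInclusion_cornerCocycle, hw.cocycle_one_right]
    exact (M.cornerInclusion_one p hp hpM).symm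
  cocycle_one_left g := by
    apply Subtype.ext
    apply M.cornerInclusion_injective p hp hpM
    rw [cornerInclusion_cornerCocycle, hw.cocycle_one_left]
    exact (M.cornerInclusion_one p hp hpM).symm

/-- By contraposition: a unitary of `pMp` implementing the perturbed automorphism is spread over `M`
by the `r i` to a unitary implementing `α g`. -/
theorem cornerCocycleAction_isProperlyOuter {ι : Type*} (s : Finset ι) (r : ι → M)
    (hr : ∀ i ∈ s, r i * ⟨p, hpM⟩ = r i) (hsum : ∑ i ∈ s, r i * star (r i) = 1)
    (hα : (CocycleAction.ofAction α).IsProperlyOuter) :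
    (cornerCocycleAction hp hw).IsProperlyOuter := by
  rintro g hg ⟨u, hu⟩
  refine hα g hg (hw.exists_unitary_of_corner s r hr hsum g
    (u := M.cornerInclusion p hp hpM (u : M.corner p hp hpM)) ?_ ?_ ?_)
  · rw [← cornerInclusion_star, ← cornerInclusion_mul, Unitary.mul_star_self_of_mem u.2,
      cornerInclusion_one]
  · rw [← cornerInclusion_star, ← cornerInclusion_mul, Unitary.star_mul_self_of_mem u.2,
      cornerInclusion_one]
  · intro x hx
    obtain ⟨T, rfl⟩ := M.exists_cornerInclusion_eq p hp hpM hx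
    rw [← cornerInclusion_star, ← cornerInclusion_mul, ← cornerInclusion_mul, ← hu T]
    exact (cornerInclusion_cornerAct hp hw g T).symm

end Perturbation

end VonNeumannAlgebra

/-! ### Compression and dilation by an isometry -/

section Compression

variable {K L : Type*} [NormedAddCommGroup K] [InnerProductSpace ℂ K] [CompleteSpace K]
  [NormedAddCommGroup L] [InnerProductSpace ℂ L] [CompleteSpace L]

/-- The compression `T ↦ J* T J`. -/
def compressBy (J : K →L[ℂ] L) : (L →L[ℂ] L) →ₗ[ℂ] (K →L[ℂ] K) where
  toFun T := ContinuousLinearMap.adjoint J ∘L T ∘L J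
  map_add' S T := by ext; simp
  map_smul' c T := by ext; simp

/-- The dilation `Z ↦ J Z J*`. -/
def dilateBy (J : K →L[ℂ] L) : (K →L[ℂ] K) →ₗ[ℂ] (L →L[ℂ] L) where
  toFun Z := J ∘L Z ∘L ContinuousLinearMap.adjoint J
  map_add' S T := by ext; simp
  map_smul' c T := by ext; simp

theorem compressBy_star (J : K →L[ℂ] L) (T : L →L[ℂ] L) :
    compressBy J (star T) = star (compressBy J T) := by
  show _ = ContinuousLinearMap.adjoint _
  simp [compressBy, ContinuousLinearMap.adjoint_comp, ContinuousLinearMap.star_eq_adjoint,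
    ContinuousLinearMap.comp_assoc]

theorem dilateBy_star (J : K →L[ℂ] L) (Z : K →L[ℂ] K) :
    dilateBy J (star Z) = star (dilateBy J Z) := by
  show _ = ContinuousLinearMap.adjoint _
  simp [dilateBy, ContinuousLinearMap.adjoint_comp, ContinuousLinearMap.star_eq_adjoint,
    ContinuousLinearMap.comp_assoc]

variable {J : K →L[ℂ] L} (hJ : ContinuousLinearMap.adjoint J ∘L J = 1)
include hJ

theorem adjoint_apply_apply (ξ : K) : ContinuousLinearMap.adjoint J (J ξ) = ξ :=
  congrArg (fun T : K →L[ℂ] K => T ξ) hJ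

/-- Compressions of concrete generators are computed this way, from an intertwining relation instead
of from the adjoint of `J`. -/
theorem compressBy_of_intertwine {T : L →L[ℂ] L} {Z : K →L[ℂ] K} (h : T ∘L J = J ∘L Z) :
    compressBy J T = Z := by
  show ContinuousLinearMap.adjoint J ∘L (T ∘L J) = Z
  rw [h, ← ContinuousLinearMap.comp_assoc, hJ]
  rfl

omit hJ [CompleteSpace K] [CompleteSpace L] in
theorem intertwine_mul {S T : L →L[ℂ] L} {Y Z : K →L[ℂ] K} (hS : S ∘L J = J ∘L Y)
    (hT : T ∘L J = J ∘L Z) : (S * T) ∘L J = J ∘L (Y * Z) := by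
  show (S ∘L T) ∘L J = J ∘L (Y ∘L Z)
  rw [ContinuousLinearMap.comp_assoc, hT, ← ContinuousLinearMap.comp_assoc, hS,
    ContinuousLinearMap.comp_assoc]

theorem compressBy_dilateBy (Z : K →L[ℂ] K) : compressBy J (dilateBy J Z) = Z := by
  ext ξ; simp [compressBy, dilateBy, adjoint_apply_apply hJ]

theorem dilateBy_mul (Z W : K →L[ℂ] K) : dilateBy J (Z * W) = dilateBy J Z * dilateBy J W := by
  ext ξ; simp [dilateBy, adjoint_apply_apply hJ]

theorem compressBy_mul_dilateBy (T : L →L[ℂ] L) (Z : K →L[ℂ] K) :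
    compressBy J (T * dilateBy J Z) = compressBy J T * Z := by
  ext ξ; simp [dilateBy, compressBy, adjoint_apply_apply hJ]

theorem compressBy_dilateBy_mul (T : L →L[ℂ] L) (Z : K →L[ℂ] K) :
    compressBy J (dilateBy J Z * T) = Z * compressBy J T := by
  ext ξ; simp [dilateBy, compressBy, adjoint_apply_apply hJ]

variable {E : L →L[ℂ] L} (hE : J ∘L ContinuousLinearMap.adjoint J = E)
include hE

theorem dilateBy_mul_proj (Z : K →L[ℂ] K) : dilateBy J Z * E = dilateBy J Z := by
  ext ξ; simp [dilateBy, ← hE, adjoint_apply_apply hJ]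

theorem proj_mul_dilateBy (Z : K →L[ℂ] K) : E * dilateBy J Z = dilateBy J Z := by
  ext ξ; simp [dilateBy, ← hE, adjoint_apply_apply hJ]

omit hJ in
theorem dilateBy_compressBy (T : L →L[ℂ] L) : dilateBy J (compressBy J T) = E * T * E := by
  ext ξ; simp [dilateBy, compressBy, ← hE]

omit hJ in
theorem compressBy_mul_compressBy (S T : L →L[ℂ] L) :
    compressBy J S * compressBy J T = compressBy J (S * E * T) := by
  ext ξ; simp [compressBy, ← hE]

theorem compressBy_proj_mul (T : L →L[ℂ] L) : compressBy J (E * T) = compressBy J T := by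
  ext ξ; simp [compressBy, ← hE, adjoint_apply_apply hJ]

theorem compressBy_mul_proj (T : L →L[ℂ] L) : compressBy J (T * E) = compressBy J T := by
  ext ξ; simp [compressBy, ← hE, adjoint_apply_apply hJ]

theorem compressBy_proj : compressBy J E = 1 := by
  ext ξ; simp [compressBy, ← hE, adjoint_apply_apply hJ]

/-- An operator commuting with the range projection leaves the range of `J` invariant, so it can be
moved inside the dilation as its own compression. -/
theorem mul_dilateBy {T : L →L[ℂ] L} (hT : E * T = T * E) (Z : K →L[ℂ] K) :
    T * dilateBy J Z = dilateBy J (compressBy J T * Z) := by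
  have hEE : E * E = E := by
    ext ξ; simp [← hE, adjoint_apply_apply hJ]
  rw [dilateBy_mul hJ, dilateBy_compressBy hE, hT, mul_assoc T, hEE, mul_assoc,
    proj_mul_dilateBy hJ hE]

theorem dilateBy_mul' {T : L →L[ℂ] L} (hT : E * T = T * E) (Z : K →L[ℂ] K) :
    dilateBy J Z * T = dilateBy J (Z * compressBy J T) := by
  have hEE : E * E = E := by
    ext ξ; simp [← hE, adjoint_apply_apply hJ]
  rw [dilateBy_mul hJ, dilateBy_compressBy hE, mul_assoc E, ← hT, ← mul_assoc E, hEE, ← mul_assoc,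
    dilateBy_mul_proj hJ hE]

end Compression

/-- If `∑ aᵢ aᵢ* = 1` and `w` commutes with all `aᵢ* x aⱼ`, then `∑ aᵢ w aᵢ*` commutes with `x`. -/
theorem commute_sum_conj {A : Type*} [Ring A] [StarRing A] {ι : Type*} {s : Finset ι} {a : ι → A}
    (ha : ∑ i ∈ s, a i * star (a i) = 1) {x w : A}
    (h : ∀ i ∈ s, ∀ j ∈ s, star (a i) * x * a j * w = w * (star (a i) * x * a j)) :
    x * ∑ i ∈ s, a i * w * star (a i) = (∑ i ∈ s, a i * w * star (a i)) * x := by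
  calc x * ∑ i ∈ s, a i * w * star (a i)
      = (∑ i ∈ s, a i * star (a i)) * (x * ∑ j ∈ s, a j * w * star (a j)) := by rw [ha, one_mul]
    _ = ∑ i ∈ s, ∑ j ∈ s, a i * (star (a i) * x * a j * w) * star (a j) := by
        rw [Finset.mul_sum, Finset.sum_mul_sum]
        simp only [mul_assoc]
    _ = ∑ i ∈ s, ∑ j ∈ s, a i * (w * (star (a i) * x * a j)) * star (a j) :=
        Finset.sum_congr rfl fun i hi => Finset.sum_congr rfl fun j hj => by rw [h i hi j hj]
    _ = ((∑ i ∈ s, a i * w * star (a i)) * x) * ∑ j ∈ s, a j * star (a j) := by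
        rw [Finset.sum_mul, Finset.sum_mul_sum]
        simp only [mul_assoc]
    _ = _ := by rw [ha, mul_one]

/-! ### Reduction of a von Neumann algebra by projections in it and in its commutant -/

namespace VonNeumannAlgebra

/-- The generated algebra is the bicommutant of `S ∪ S*`; commutation with `S*` is obtained by
taking adjoints in `h'`. -/
theorem mem_commutant_generatedBy {H : Type*} [NormedAddCommGroup H] [InnerProductSpace ℂ H]
    [CompleteSpace H] {S : Set (H →L[ℂ] H)} {y : H →L[ℂ] H}
    (h : ∀ x ∈ S, x * y = y * x) (h' : ∀ x ∈ S, x * star y = star y * x) :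
    y ∈ (generatedBy S).commutant := by
  rw [← SetLike.mem_coe, coe_commutant]
  show y ∈ Set.centralizer ((StarSubalgebra.centralizer ℂ
      (StarSubalgebra.centralizer ℂ S : Set (H →L[ℂ] H)) : Set (H →L[ℂ] H)))
  rw [StarSubalgebra.coe_centralizer_centralizer, Set.centralizer_centralizer_centralizer]
  rintro x (hx | hx)
  · exact h x hx
  · have := congrArg star (h' _ hx)
    simpa using this.symm

section Reduction

variable {K L : Type*} [NormedAddCommGroup K] [InnerProductSpace ℂ K] [CompleteSpace K]
  [NormedAddCommGroup L] [InnerProductSpace ℂ L] [CompleteSpace L]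

/-- The isometry `J : K → L`, with range projection `PQ`, `P ∈ N` and `Q ∈ N'` of central support
one (as witnessed by `a` and `b`), identifies the von Neumann algebra on `K` generated by `S₂`
with the algebra obtained from `PNP` by restriction to the range of `Q`, where `N` is generated
by `S`. -/
structure IsReduction (S : Set (L →L[ℂ] L)) (S₂ : Set (K →L[ℂ] K)) (P Q : L →L[ℂ] L)
    (J : K →L[ℂ] L) {ι : Type*} (s : Finset ι) (a b : ι → L →L[ℂ] L) : Prop where
  adjoint_comp : ContinuousLinearMap.adjoint J ∘L J = 1
  comp_adjoint : J ∘L ContinuousLinearMap.adjoint J = P * Q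
  left_proj : IsStarProjection P
  left_mem : P ∈ generatedBy S
  right_proj : IsStarProjection Q
  right_mem : Q ∈ (generatedBy S).commutant
  a_mem : ∀ i ∈ s, a i ∈ generatedBy S
  a_mul : ∀ i ∈ s, a i * P = a i
  a_sum : ∑ i ∈ s, a i * star (a i) = 1
  b_mem : ∀ i ∈ s, b i ∈ (generatedBy S).commutant
  b_mul : ∀ i ∈ s, b i * Q = b i
  b_sum : ∑ i ∈ s, b i * star (b i) = 1
  exists_lift : ∀ y ∈ S₂, ∃ t ∈ generatedBy S, P * t * P = t ∧ compressBy J t = y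
  compress_mem : ∀ i ∈ s, ∀ j ∈ s, ∀ x ∈ S, compressBy J (star (a i) * x * a j) ∈ generatedBy S₂
  compress_mem_one : ∀ i ∈ s, compressBy J (P * a i) ∈ generatedBy S₂

namespace IsReduction

variable {S : Set (L →L[ℂ] L)} {S₂ : Set (K →L[ℂ] K)} {P Q : L →L[ℂ] L}
    {J : K →L[ℂ] L} {ι : Type*} {s : Finset ι} {a b : ι → L →L[ℂ] L}
    (h : IsReduction S S₂ P Q J s a b)
include h

theorem proj_comm : P * Q = Q * P := commute_of_mem _ h.left_mem h.right_mem

/-- Elements of `PNP` commute with `J J* = P Q` because `Q ∈ N'`. This makes the compression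
multiplicative as soon as one factor lies in `PNP`. -/
theorem comm_of_mem {T : L →L[ℂ] L} (hT : T ∈ generatedBy S) (hP : P * T * P = T) :
    P * Q * T = T * (P * Q) := by
  obtain ⟨h1, h2⟩ := mul_eq_of_corner h.left_proj hP
  rw [h.proj_comm, mul_assoc, h1, ← h.proj_comm, ← mul_assoc, h2,
    commute_of_mem _ hT h.right_mem]

theorem comm_of_mem' {T : L →L[ℂ] L} (hT : T ∈ (generatedBy S).commutant) (hQ : Q * T * Q = T) :
    P * Q * T = T * (P * Q) := by
  obtain ⟨h1, h2⟩ := mul_eq_of_corner h.right_proj hQ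
  rw [mul_assoc, h1, h.proj_comm, ← mul_assoc, h2, commute_of_mem _ h.left_mem hT]

theorem proj_mul_dilate (Z : K →L[ℂ] K) : P * dilateBy J Z = dilateBy J Z := by
  rw [← proj_mul_dilateBy h.adjoint_comp h.comp_adjoint, ← mul_assoc, ← mul_assoc,
    h.left_proj.isIdempotentElem]

theorem dilate_mul_proj (Z : K →L[ℂ] K) : dilateBy J Z * P = dilateBy J Z := by
  rw [← dilateBy_mul_proj h.adjoint_comp h.comp_adjoint, h.proj_comm, mul_assoc, mul_assoc,
    h.left_proj.isIdempotentElem]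

theorem dilate_mul_proj' (Z : K →L[ℂ] K) : dilateBy J Z * Q = dilateBy J Z := by
  rw [← dilateBy_mul_proj h.adjoint_comp h.comp_adjoint, mul_assoc, mul_assoc,
    h.right_proj.isIdempotentElem]

theorem compress_mul {T : L →L[ℂ] L} (hT : T ∈ generatedBy S) (hP : P * T * P = T)
    (X : L →L[ℂ] L) : compressBy J T * compressBy J X = compressBy J (T * X) := by
  rw [compressBy_mul_compressBy h.comp_adjoint, ← h.comm_of_mem hT hP, mul_assoc,
    compressBy_proj_mul h.adjoint_comp h.comp_adjoint]

theorem compress_mul' {T : L →L[ℂ] L} (hT : T ∈ generatedBy S) (hP : P * T * P = T)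
    (X : L →L[ℂ] L) : compressBy J X * compressBy J T = compressBy J (X * T) := by
  rw [compressBy_mul_compressBy h.comp_adjoint, mul_assoc, h.comm_of_mem hT hP, ← mul_assoc,
    compressBy_mul_proj h.adjoint_comp h.comp_adjoint]

theorem proj_mul_star_a {i : ι} (hi : i ∈ s) : P * star (a i) = star (a i) := by
  have := congrArg star (h.a_mul i hi)
  rwa [star_mul, h.left_proj.isSelfAdjoint.star_eq] at this

theorem proj_mul_star_b {i : ι} (hi : i ∈ s) : Q * star (b i) = star (b i) := by
  have := congrArg star (h.b_mul i hi)
  rwa [star_mul, h.right_proj.isSelfAdjoint.star_eq] at this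

/-- The extension of an element of the commutant of the algebra on `K` to the commutant of `N`. -/
theorem lift_commutant_mem {Z : K →L[ℂ] K} (hZ : Z ∈ (generatedBy S₂).commutant) :
    ∑ i ∈ s, a i * dilateBy J Z * star (a i) ∈ (generatedBy S).commutant := by
  have key : ∀ Z ∈ (generatedBy S₂).commutant, ∀ x ∈ S,
      x * ∑ i ∈ s, a i * dilateBy J Z * star (a i) =
        (∑ i ∈ s, a i * dilateBy J Z * star (a i)) * x := by
    intro Z hZ x hx
    refine commute_sum_conj h.a_sum fun i hi j hj => ?_
    have hmem : star (a i) * x * a j ∈ generatedBy S :=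
      mul_mem (mul_mem (star_mem (h.a_mem i hi)) (subset_generatedBy S hx)) (h.a_mem j hj)
    have hP : P * (star (a i) * x * a j) * P = star (a i) * x * a j := by
      rw [← mul_assoc, ← mul_assoc, h.proj_mul_star_a hi, mul_assoc, h.a_mul j hj]
    have hc := h.comm_of_mem hmem hP
    rw [mul_dilateBy h.adjoint_comp h.comp_adjoint hc,
      dilateBy_mul' h.adjoint_comp h.comp_adjoint hc,
      commute_of_mem _ (h.compress_mem i hi j hj x hx) hZ]
  refine mem_commutant_generatedBy (key Z hZ) ?_
  have : star (∑ i ∈ s, a i * dilateBy J Z * star (a i)) =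
      ∑ i ∈ s, a i * dilateBy J (star Z) * star (a i) := by
    rw [star_sum]
    simp only [star_mul, star_star, dilateBy_star, mul_assoc]
  rw [this]
  exact key _ (star_mem hZ)

/-- By the bicommutant theorem it suffices to commute with each `Z` in the commutant on `K`. Such a
`Z` comes from some `Y ∈ N'` with `P Y P = J Z J*`, and `T` commutes with `Y`. -/
theorem compress_mem_generated {T : L →L[ℂ] L} (hT : T ∈ generatedBy S) (hP : P * T * P = T) :
    compressBy J T ∈ generatedBy S₂ := by
  refine mem_of_commute _ fun Z hZ => ?_
  set Y := ∑ i ∈ s, a i * dilateBy J Z * star (a i) with hY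
  have hYmem : Y ∈ (generatedBy S).commutant := h.lift_commutant_mem hZ
  -- Each `P a_i` lies in `PNP` and has compression in the algebra on `K`, so it passes through `J Z
  -- J*`; what remains is `∑ a_i a_i* = 1`.
  have hPY : P * Y * P = dilateBy J Z := by
    have h1 : ∀ i ∈ s, P * (a i * dilateBy J Z * star (a i)) * P =
        dilateBy J Z * (P * (a i * star (a i)) * P) := by
      intro i hi
      have hc : P * Q * (P * a i) = P * a i * (P * Q) :=
        h.comm_of_mem (mul_mem h.left_mem (h.a_mem i hi)) (by
          rw [← mul_assoc, h.left_proj.isIdempotentElem, mul_assoc, h.a_mul i hi])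
      have h2 : P * a i * dilateBy J Z = dilateBy J Z * (P * a i) := by
        rw [mul_dilateBy h.adjoint_comp h.comp_adjoint hc,
          dilateBy_mul' h.adjoint_comp h.comp_adjoint hc,
          commute_of_mem _ (h.compress_mem_one i hi) hZ]
      calc _ = P * a i * dilateBy J Z * star (a i) * P := by simp only [mul_assoc]
        _ = _ := by rw [h2]; simp only [mul_assoc]
    rw [hY, Finset.mul_sum, Finset.sum_mul, Finset.sum_congr rfl h1, ← Finset.mul_sum,
      ← Finset.sum_mul, ← Finset.mul_sum, h.a_sum, mul_one, h.left_proj.isIdempotentElem,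
      h.dilate_mul_proj]
  obtain ⟨h1, h2⟩ := mul_eq_of_corner h.left_proj hP
  rw [← compressBy_mul_dilateBy h.adjoint_comp, ← compressBy_dilateBy_mul h.adjoint_comp, ← hPY]
  congr 1
  rw [mul_assoc P, mul_assoc P, mul_assoc Y, h1, ← commute_of_mem _ hT hYmem, ← mul_assoc P T, h1,
    ← mul_assoc, h2, ← mul_assoc, commute_of_mem _ hT hYmem, mul_assoc, h2]

/-- It suffices to test against generators on `K`. These are compressions of elements `t ∈ PNP`, so
both products are compressions of `t d = d t`. -/
theorem compress_mem_commutant {d : L →L[ℂ] L} (hd : d ∈ (generatedBy S).commutant) :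
    compressBy J d ∈ (generatedBy S₂).commutant := by
  have key : ∀ d ∈ (generatedBy S).commutant, ∀ y ∈ S₂,
      y * compressBy J d = compressBy J d * y := by
    intro d hd y hy
    obtain ⟨t, ht, hP, rfl⟩ := h.exists_lift y hy
    rw [h.compress_mul ht hP, h.compress_mul' ht hP, commute_of_mem _ ht hd]
  refine mem_commutant_generatedBy (key d hd) ?_
  rw [← compressBy_star]
  exact key _ (star_mem hd)

theorem dilate_comm {Z : K →L[ℂ] K} (hZ : Z ∈ generatedBy S₂) {d : L →L[ℂ] L}
    (hd : d ∈ (generatedBy S).commutant) (hQ : Q * d * Q = d) :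
    d * dilateBy J Z = dilateBy J Z * d := by
  have hc := h.comm_of_mem' hd hQ
  rw [mul_dilateBy h.adjoint_comp h.comp_adjoint hc,
      dilateBy_mul' h.adjoint_comp h.comp_adjoint hc,
    commute_of_mem _ hZ (h.compress_mem_commutant hd)]

/-- Surjectivity, by the dual construction: `T = ∑ b_i J Z J* b_i*` commutes with `N'`, hence lies
in `N`, and `Q T Q = J Z J*`. It lies in `PNP` since the `b_i` commute with `P`. -/
theorem exists_compress_eq {Z : K →L[ℂ] K} (hZ : Z ∈ generatedBy S₂) :
    ∃ T ∈ generatedBy S, P * T * P = T ∧ compressBy J T = Z := by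
  have hPb : ∀ i ∈ s, P * (b i * dilateBy J Z * star (b i)) * P =
      b i * dilateBy J Z * star (b i) := by
    intro i hi
    have e1 := commute_of_mem _ h.left_mem (h.b_mem i hi)
    have e2 := commute_of_mem _ h.left_mem (star_mem (h.b_mem i hi))
    rw [← mul_assoc, ← mul_assoc, e1, mul_assoc (b i), h.proj_mul_dilate, mul_assoc, ← e2,
      ← mul_assoc, mul_assoc (b i), h.dilate_mul_proj]
  have hQb : ∀ i ∈ s, Q * (b i * dilateBy J Z * star (b i)) * Q =
      dilateBy J Z * (Q * (b i * star (b i)) * Q) := by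
    intro i hi
    have h2 := h.dilate_comm hZ (mul_mem h.right_mem (h.b_mem i hi)) (by
      rw [← mul_assoc, h.right_proj.isIdempotentElem, mul_assoc, h.b_mul i hi])
    calc _ = Q * b i * dilateBy J Z * star (b i) * Q := by simp only [mul_assoc]
      _ = _ := by rw [h2]; simp only [mul_assoc]
  refine ⟨∑ i ∈ s, b i * dilateBy J Z * star (b i), ?_, ?_, ?_⟩
  · refine mem_of_commute _ fun Y hY => ?_
    refine commute_sum_conj h.b_sum fun i hi j hj => ?_
    refine h.dilate_comm hZ
      (mul_mem (mul_mem (star_mem (h.b_mem i hi)) hY) (h.b_mem j hj)) ?_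
    rw [← mul_assoc, ← mul_assoc, h.proj_mul_star_b hi, mul_assoc, h.b_mul j hj]
  · rw [Finset.mul_sum, Finset.sum_mul, Finset.sum_congr rfl hPb]
  · set T := ∑ i ∈ s, b i * dilateBy J Z * star (b i) with hT
    have h1 : P * T * P = T := by rw [hT, Finset.mul_sum, Finset.sum_mul, Finset.sum_congr rfl hPb]
    have h2 : Q * T * Q = dilateBy J Z := by
      rw [hT, Finset.mul_sum, Finset.sum_mul, Finset.sum_congr rfl hQb, ← Finset.mul_sum,
        ← Finset.sum_mul, ← Finset.mul_sum, h.b_sum, mul_one, h.right_proj.isIdempotentElem,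
        h.dilate_mul_proj']
    rw [← compressBy_proj_mul h.adjoint_comp h.comp_adjoint,
      ← compressBy_mul_proj h.adjoint_comp h.comp_adjoint]
    have h3 : P * Q * T * (P * Q) = P * (Q * T * Q) * P := by
      rw [congrArg (P * Q * T * ·) h.proj_comm]
      simp only [mul_assoc]
    rw [h3, h2, h.proj_mul_dilate, h.dilate_mul_proj, compressBy_dilateBy h.adjoint_comp]

/-- A vanishing compression means `T Q = 0`. Since `T` commutes with the `b_i = b_i Q`, the
partition `∑ b_i b_i* = 1` then gives `T = 0`. -/
theorem eq_zero_of_compress {T : L →L[ℂ] L} (hT : T ∈ generatedBy S) (hP : P * T * P = T)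
    (h0 : compressBy J T = 0) : T = 0 := by
  have h1 : T * Q = 0 := by
    have h2 := dilateBy_compressBy h.comp_adjoint T
    have hEE : P * Q * (P * Q) = P * Q := by
      calc P * Q * (P * Q) = P * (Q * P) * Q := by simp only [mul_assoc]
        _ = P * P * (Q * Q) := by rw [← h.proj_comm]; simp only [mul_assoc]
        _ = P * Q := by rw [h.left_proj.isIdempotentElem, h.right_proj.isIdempotentElem]
    rw [h0, map_zero, h.comm_of_mem hT hP, mul_assoc, hEE, ← mul_assoc,
      (mul_eq_of_corner h.left_proj hP).2] at h2
    exact h2.symm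
  rw [← mul_one T, ← h.b_sum, Finset.mul_sum]
  refine Finset.sum_eq_zero fun i hi => ?_
  rw [← h.proj_mul_star_b hi, ← mul_assoc, commute_of_mem _ hT (h.b_mem i hi), mul_assoc,
    ← mul_assoc T, h1, zero_mul, mul_zero]

theorem corner_cornerExtend (T : (generatedBy S).corner P h.left_proj h.left_mem) :
    P * cornerExtend P (T : cornerSpace P →L[ℂ] cornerSpace P) * P =
      cornerExtend P (T : cornerSpace P →L[ℂ] cornerSpace P) :=
  congrArg Subtype.val ((generatedBy S).corner_cornerInclusion P h.left_proj h.left_mem T)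

/-- Compression by `J` as a *-homomorphism on the corner `PNP`. -/
def compressHom : (generatedBy S).corner P h.left_proj h.left_mem →⋆ₐ[ℂ] generatedBy S₂ where
  toFun T := ⟨compressBy J (cornerExtend P (T : cornerSpace P →L[ℂ] cornerSpace P)),
    h.compress_mem_generated T.2 (h.corner_cornerExtend T)⟩
  map_one' := Subtype.ext (by
    show compressBy J (cornerExtend P 1) = 1
    rw [cornerExtend_one h.left_proj, ← compressBy_mul_proj h.adjoint_comp h.comp_adjoint,
      ← mul_assoc, h.left_proj.isIdempotentElem, compressBy_proj h.adjoint_comp h.comp_adjoint])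
  map_mul' S T := Subtype.ext (by
    show compressBy J (cornerExtend P (S * T : cornerSpace P →L[ℂ] cornerSpace P)) =
      compressBy J _ * compressBy J _
    rw [h.compress_mul S.2 (h.corner_cornerExtend S), cornerExtend_mul])
  map_zero' := Subtype.ext (by
    show compressBy J (cornerExtend P 0) = 0
    rw [show cornerExtend P 0 = 0 by ext; simp [cornerExtend], map_zero])
  map_add' S T := Subtype.ext (by
    show compressBy J (cornerExtend P (S + T : cornerSpace P →L[ℂ] cornerSpace P)) =
      compressBy J _ + compressBy J _
    rw [cornerExtend_add, map_add])
  commutes' c := Subtype.ext (by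
    show compressBy J (cornerExtend P (algebraMap ℂ _ c)) = algebraMap ℂ _ c
    rw [Algebra.algebraMap_eq_smul_one, Algebra.algebraMap_eq_smul_one, cornerExtend_smul,
      map_smul, cornerExtend_one h.left_proj,
      ← compressBy_mul_proj h.adjoint_comp h.comp_adjoint,
      ← mul_assoc, h.left_proj.isIdempotentElem, compressBy_proj h.adjoint_comp h.comp_adjoint])
  map_star' T := Subtype.ext (by
    show compressBy J (cornerExtend P (star T : cornerSpace P →L[ℂ] cornerSpace P)) =
      star (compressBy J _)
    rw [cornerExtend_star, compressBy_star])

theorem compressHom_bijective : Function.Bijective h.compressHom := by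
  constructor
  · rw [injective_iff_map_eq_zero]
    intro T hT
    have h1 := h.eq_zero_of_compress T.2 (h.corner_cornerExtend T) (congrArg Subtype.val hT)
    apply Subtype.ext
    apply cornerExtend_injective P
    rw [h1]
    ext; simp [cornerExtend]
  · rintro ⟨Z, hZ⟩
    obtain ⟨T, hT, hP, rfl⟩ := h.exists_compress_eq hZ
    obtain ⟨T', hT'⟩ := (generatedBy S).exists_cornerInclusion_eq P h.left_proj h.left_mem
      (x := ⟨T, hT⟩) (Subtype.ext hP)
    exact ⟨T', Subtype.ext (congrArg (compressBy J) (congrArg Subtype.val hT'))⟩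

/-- Compression by `J` is a *-isomorphism of the corner `PNP` onto the algebra on `K`. -/
def compressEquiv : (generatedBy S).corner P h.left_proj h.left_mem ≃⋆ₐ[ℂ] generatedBy S₂ :=
  StarAlgEquiv.ofBijective h.compressHom h.compressHom_bijective

/-- The isomorphism of a corner with its reduction carries subalgebras that correspond under
compression onto each other. -/
theorem isomorphicInclusions {A₁ : StarSubalgebra ℂ (L →L[ℂ] L)} (hP : P ∈ A₁)
    {A₂ : StarSubalgebra ℂ (K →L[ℂ] K)} (hA₁ : ∀ x ∈ A₁, x ∈ generatedBy S)
    (hA₂ : ∀ x ∈ A₂, x ∈ generatedBy S₂)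
    (hto : ∀ x ∈ A₁, compressBy J (P * x * P) ∈ A₂)
    (hfrom : ∀ y ∈ A₂, ∃ x ∈ A₁, P * x * P = x ∧ compressBy J x = y) :
    IsomorphicInclusions (A₁.corner P h.left_proj hP)
      ((generatedBy S).corner P h.left_proj h.left_mem) A₂ (generatedBy S₂) := by
  refine ⟨fun T hT => hA₁ _ hT, hA₂, h.compressEquiv, Set.Subset.antisymm ?_ ?_⟩
  · rintro _ ⟨T, hT, rfl⟩
    have h1 := hto _ hT
    rw [h.corner_cornerExtend] at h1
    exact h1
  · rintro ⟨y, hy'⟩ hy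
    obtain ⟨x, hx, hPx, rfl⟩ := hfrom y hy
    have hT : cornerExtend P (cornerCompress P x) = x := by
      rw [cornerExtend_cornerCompress P h.left_proj, hPx]
    refine ⟨⟨cornerCompress P x, ?_⟩, ?_, Subtype.ext (congrArg (compressBy J) hT)⟩
    · rw [mem_corner, hT]
      exact hA₁ x hx
    · show cornerExtend P (cornerCompress P x) ∈ A₁
      rwa [hT]

end IsReduction

end Reduction

end VonNeumannAlgebra

/-! ### Diagonal operators between `ℓ²` spaces -/

section DiagonalOperator

variable {G : Type*} {E F E' : Type*} [NormedAddCommGroup E] [InnerProductSpace ℂ E]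
  [NormedAddCommGroup F] [InnerProductSpace ℂ F] [NormedAddCommGroup E'] [InnerProductSpace ℂ E']

theorem sum_norm_diagonal_le (T : G → E →L[ℂ] F) (C : ℝ) (hC : 0 ≤ C) (hT : ∀ g, ‖T g‖ ≤ C)
    (f : lp (fun _ : G => E) 2) (s : Finset G) :
    ∑ g ∈ s, ‖T g (f g)‖ ^ (2 : ℝ≥0∞).toReal ≤ (C * ‖f‖) ^ (2 : ℝ≥0∞).toReal := by
  have h2 : 0 < (2 : ℝ≥0∞).toReal := by norm_num
  calc ∑ g ∈ s, ‖T g (f g)‖ ^ (2 : ℝ≥0∞).toReal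
      ≤ ∑ g ∈ s, C ^ (2 : ℝ≥0∞).toReal * ‖f g‖ ^ (2 : ℝ≥0∞).toReal := by
        refine Finset.sum_le_sum fun g _ => ?_
        rw [← Real.mul_rpow hC (norm_nonneg _)]
        exact Real.rpow_le_rpow (norm_nonneg _) ((T g).le_of_opNorm_le (hT g) _) h2.le
    _ = C ^ (2 : ℝ≥0∞).toReal * ∑ g ∈ s, ‖f g‖ ^ (2 : ℝ≥0∞).toReal := by
        rw [Finset.mul_sum]
    _ ≤ C ^ (2 : ℝ≥0∞).toReal * ‖f‖ ^ (2 : ℝ≥0∞).toReal :=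
        mul_le_mul_of_nonneg_left (lp.sum_rpow_le_norm_rpow h2 f _) (Real.rpow_nonneg hC _)
    _ = (C * ‖f‖) ^ (2 : ℝ≥0∞).toReal := (Real.mul_rpow hC (norm_nonneg _)).symm

/-- The diagonal operator `f ↦ (g ↦ T_g f(g))` on `ℓ²`, for a bounded family of operators `T_g`. -/
def lpDiagonal (T : G → E →L[ℂ] F) (C : ℝ) (hC : 0 ≤ C) (hT : ∀ g, ‖T g‖ ≤ C) :
    lp (fun _ : G => E) 2 →L[ℂ] lp (fun _ : G => F) 2 :=
  LinearMap.mkContinuous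
    { toFun := fun f => ⟨fun g => T g (f g),
        memℓp_gen' (sum_norm_diagonal_le T C hC hT f)⟩
      map_add' := fun f f' => lp.ext (funext fun g => map_add (T g) _ _)
      map_smul' := fun c f => lp.ext (funext fun g => map_smul (T g) c _) }
    C (fun f => lp.norm_le_of_forall_sum_le (by norm_num)
      (mul_nonneg hC (norm_nonneg _)) (sum_norm_diagonal_le T C hC hT f))

@[simp]
theorem lpDiagonal_apply (T : G → E →L[ℂ] F) (C : ℝ) (hC : 0 ≤ C) (hT : ∀ g, ‖T g‖ ≤ C)
    (f : lp (fun _ : G => E) 2) (g : G) : lpDiagonal T C hC hT f g = T g (f g) := rfl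

theorem adjoint_lpDiagonal_apply [CompleteSpace E] [CompleteSpace F] (T : G → E →L[ℂ] F) (C : ℝ)
    (hC : 0 ≤ C) (hT : ∀ g, ‖T g‖ ≤ C) (f : lp (fun _ : G => F) 2) (g : G) :
    ContinuousLinearMap.adjoint (lpDiagonal T C hC hT) f g =
      ContinuousLinearMap.adjoint (T g) (f g) := by
  have : lpDiagonal (fun g => ContinuousLinearMap.adjoint (T g)) C hC
      (fun g => by rw [LinearIsometryEquiv.norm_map]; exact hT g) =
      ContinuousLinearMap.adjoint (lpDiagonal T C hC hT) := by
    rw [ContinuousLinearMap.eq_adjoint_iff]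
    intro f f'
    rw [lp.inner_eq_tsum, lp.inner_eq_tsum]
    refine tsum_congr fun g => ?_
    rw [lpDiagonal_apply, lpDiagonal_apply, ContinuousLinearMap.adjoint_inner_left]
  rw [← this, lpDiagonal_apply]

end DiagonalOperator

/-! ### Left and right multiplication on `L²(M, τ)`, and the embedding of `L²(pMp)` -/

namespace VonNeumannAlgebra.TraceState

variable {H : Type u} [NormedAddCommGroup H] [InnerProductSpace ℂ H] [CompleteSpace H]
  {M : VonNeumannAlgebra H} (τ : M.TraceState)

/-- The canonical map of `M` into `L²(M, τ)`. -/
def toL2 : M →ₗ[ℂ] τ.L2 where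
  toFun x := ((τ.toPositiveLinearMap.toPreGNS x : τ.toPositiveLinearMap.PreGNS) :
    UniformSpace.Completion τ.toPositiveLinearMap.PreGNS)
  map_add' x y := by rw [map_add, UniformSpace.Completion.coe_add]; rfl
  map_smul' c x := by rw [map_smul, UniformSpace.Completion.coe_smul]; rfl

theorem denseRange_toL2 : DenseRange τ.toL2 :=
  UniformSpace.Completion.denseRange_coe (α := τ.toPositiveLinearMap.PreGNS)

theorem inner_toL2 (x y : M) : ⟪τ.toL2 x, τ.toL2 y⟫_ℂ = τ.toPositiveLinearMap (star x * y) :=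
  UniformSpace.Completion.inner_coe _ _

theorem leftMul_toL2 (x y : M) : τ.leftMul x (τ.toL2 y) = τ.toL2 (x * y) :=
  PositiveLinearMap.gnsNonUnitalStarAlgHom_apply_coe _

theorem ext_toL2 {F : Type*} [NormedAddCommGroup F] [NormedSpace ℂ F] {S T : τ.L2 →L[ℂ] F}
    (h : ∀ x, S (τ.toL2 x) = T (τ.toL2 x)) : S = T := by
  ext ξ
  exact congrFun (τ.denseRange_toL2.equalizer S.continuous T.continuous (funext h)) ξ

theorem norm_toL2_star (x : M) : ‖τ.toL2 (star x)‖ = ‖τ.toL2 x‖ := by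
  rw [@norm_eq_sqrt_re_inner ℂ, @norm_eq_sqrt_re_inner ℂ _ _ _ _ (τ.toL2 x), inner_toL2,
    inner_toL2, star_star]
  exact congrArg (fun z : ℂ => √(RCLike.re z)) (τ.map_mul_comm x (star x))

/-- By traciality the adjoint is isometric for the 2-norm, which turns right multiplication by `y`
into left multiplication by `y*`. -/
theorem norm_toL2_mul_le (x y : M) : ‖τ.toL2 (x * y)‖ ≤ ‖y‖ * ‖τ.toL2 x‖ := by
  rw [← norm_toL2_star, star_mul, ← leftMul_toL2, ← τ.norm_toL2_star x]
  refine ContinuousLinearMap.le_of_opNorm_le _ ?_ _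
  exact (NonUnitalStarAlgHom.norm_apply_le τ.leftMul (star y)).trans (norm_star y).le

/-- The action of `M` on `L²(M, τ)` by right multiplication. -/
def rightMul (y : M) : τ.L2 →L[ℂ] τ.L2 :=
  (τ.toL2 ∘ₗ LinearMap.mulRight ℂ y).extendOfNorm τ.toL2

theorem rightMul_toL2 (x y : M) : τ.rightMul y (τ.toL2 x) = τ.toL2 (x * y) :=
  LinearMap.extendOfNorm_eq τ.denseRange_toL2 ⟨‖y‖, fun x => τ.norm_toL2_mul_le x y⟩ x

theorem adjoint_rightMul (y : M) :
    ContinuousLinearMap.adjoint (τ.rightMul y) = τ.rightMul (star y) := by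
  refine τ.ext_toL2 fun x => τ.denseRange_toL2.eq_of_inner_left ℂ fun z => ?_
  rw [ContinuousLinearMap.adjoint_inner_left, rightMul_toL2, rightMul_toL2, inner_toL2, inner_toL2,
    star_mul, star_star, ← mul_assoc, mul_assoc y]
  exact τ.map_mul_comm _ _

theorem rightMul_mul (x y : M) : τ.rightMul (x * y) = τ.rightMul y * τ.rightMul x := by
  refine τ.ext_toL2 fun z => ?_
  show _ = τ.rightMul y (τ.rightMul x _)
  simp only [rightMul_toL2, mul_assoc]

theorem rightMul_add (x y : M) : τ.rightMul (x + y) = τ.rightMul x + τ.rightMul y := by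
  refine τ.ext_toL2 fun z => ?_
  show _ = τ.rightMul x _ + τ.rightMul y _
  simp only [rightMul_toL2, mul_add, map_add]

theorem rightMul_one : τ.rightMul 1 = 1 := by
  refine τ.ext_toL2 fun z => ?_
  rw [rightMul_toL2, mul_one]
  rfl

theorem leftMul_rightMul (x y : M) (ξ : τ.L2) :
    τ.leftMul x (τ.rightMul y ξ) = τ.rightMul y (τ.leftMul x ξ) := by
  have : τ.leftMul x ∘L τ.rightMul y = τ.rightMul y ∘L τ.leftMul x := τ.ext_toL2 fun z => by
    simp only [ContinuousLinearMap.comp_apply, rightMul_toL2, leftMul_toL2, mul_assoc]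
  exact congrArg (fun T : τ.L2 →L[ℂ] τ.L2 => T ξ) this

section Corner

variable (p : H →L[ℂ] H) (hp : IsStarProjection p) (hpM : p ∈ M) (hp0 : p ≠ 0)

theorem corner_apply (T : M.corner p hp hpM) :
    (τ.corner p hp hpM hp0).toPositiveLinearMap T =
      (τ.toPositiveLinearMap ⟨p, hpM⟩)⁻¹ *
        τ.toPositiveLinearMap (M.cornerInclusion p hp hpM T) := rfl

/-- The square root of the inverse of `τ(p)`. -/
def cornerScale : ℝ := (√(τ.toPositiveLinearMap ⟨p, hpM⟩).re)⁻¹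

include hp hp0 in
theorem cornerScale_sq : ((τ.cornerScale p hpM : ℝ) : ℂ) * (τ.cornerScale p hpM : ℝ) =
    (τ.toPositiveLinearMap ⟨p, hpM⟩)⁻¹ := by
  have h := Complex.pos_iff.1 (τ.map_projection_pos p hp hpM hp0)
  have h1 : τ.toPositiveLinearMap ⟨p, hpM⟩ = ((τ.toPositiveLinearMap ⟨p, hpM⟩).re : ℂ) :=
    Complex.ext rfl h.2.symm
  rw [h1, ← Complex.ofReal_mul, ← Complex.ofReal_inv, cornerScale, ← mul_inv,
    Real.mul_self_sqrt h.1.le]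

/-- The map `x ↦ τ(p)^(-1/2) x` of `pMp` into `L²(M, τ)`. -/
def cornerToL2 : M.corner p hp hpM →ₗ[ℂ] τ.L2 :=
  ((τ.cornerScale p hpM : ℝ) : ℂ) • (τ.toL2 ∘ₗ M.cornerInclusion p hp hpM)

theorem inner_cornerToL2 (S T : M.corner p hp hpM) :
    ⟪τ.cornerToL2 p hp hpM S, τ.cornerToL2 p hp hpM T⟫_ℂ =
      ⟪(τ.corner p hp hpM hp0).toL2 S, (τ.corner p hp hpM hp0).toL2 T⟫_ℂ := by
  rw [inner_toL2, corner_apply, ← τ.cornerScale_sq p hp hpM hp0]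
  show ⟪((τ.cornerScale p hpM : ℝ) : ℂ) • τ.toL2 (M.cornerInclusion p hp hpM S),
    ((τ.cornerScale p hpM : ℝ) : ℂ) • τ.toL2 (M.cornerInclusion p hp hpM T)⟫_ℂ = _
  rw [inner_smul_left, inner_smul_right, inner_toL2, cornerInclusion_mul, cornerInclusion_star,
    Complex.conj_ofReal, mul_assoc]

/-- The isometric embedding of `L²(pMp, τ_p)` into `L²(M, τ)`, with range `pL²(M, τ)p`. -/
def cornerEmbedding : (τ.corner p hp hpM hp0).L2 →L[ℂ] τ.L2 :=
  (τ.cornerToL2 p hp hpM).extendOfNorm (τ.corner p hp hpM hp0).toL2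

theorem cornerEmbedding_toL2 (T : M.corner p hp hpM) :
    τ.cornerEmbedding p hp hpM hp0 ((τ.corner p hp hpM hp0).toL2 T) =
      ((τ.cornerScale p hpM : ℝ) : ℂ) • τ.toL2 (M.cornerInclusion p hp hpM T) :=
  LinearMap.extendOfNorm_eq (τ.corner p hp hpM hp0).denseRange_toL2
    ⟨1, fun T => by
      rw [one_mul, @norm_eq_sqrt_re_inner ℂ, τ.inner_cornerToL2 p hp hpM hp0,
        ← @norm_eq_sqrt_re_inner ℂ]⟩ T

/-- The embedding scales by `τ(p)^(-1/2)`, and passing from `τ` to `τ_p` costs a factor `τ(p)`; so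
the adjoint is `x ↦ τ(p)^(1/2) p x p`. -/
theorem adjoint_cornerEmbedding_toL2 (x : M) :
    ContinuousLinearMap.adjoint (τ.cornerEmbedding p hp hpM hp0) (τ.toL2 x) =
      ((τ.cornerScale p hpM : ℝ) * τ.toPositiveLinearMap ⟨p, hpM⟩ : ℂ) •
        (τ.corner p hp hpM hp0).toL2 (M.toCorner p hp hpM (⟨p, hpM⟩ * x * ⟨p, hpM⟩) (by
          have h := (M.isStarProjection_mk p hp hpM).isIdempotentElem.eq
          rw [← mul_assoc, ← mul_assoc, h, mul_assoc, h])) := by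
  refine (τ.corner p hp hpM hp0).denseRange_toL2.eq_of_inner_right ℂ fun T => ?_
  have h0 := (τ.map_projection_pos p hp hpM hp0).ne'
  have h1 : τ.toPositiveLinearMap (star (M.cornerInclusion p hp hpM T) *
      (⟨p, hpM⟩ * x * ⟨p, hpM⟩)) =
      τ.toPositiveLinearMap (star (M.cornerInclusion p hp hpM T) * x) := by
    obtain ⟨h2, h3⟩ := mul_eq_of_corner (M.isStarProjection_mk p hp hpM)
      (M.corner_cornerInclusion p hp hpM (star T))
    rw [← cornerInclusion_star, ← mul_assoc, ← mul_assoc, h3]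
    refine (τ.map_mul_comm _ _).trans ?_
    rw [← mul_assoc, h2]
    rfl
  rw [ContinuousLinearMap.adjoint_inner_right, cornerEmbedding_toL2, inner_smul_left,
    inner_smul_right, inner_toL2, inner_toL2, corner_apply, cornerInclusion_mul,
    cornerInclusion_star, cornerInclusion_toCorner, h1, Complex.conj_ofReal]
  field_simp

theorem adjoint_comp_cornerEmbedding (ξ : (τ.corner p hp hpM hp0).L2) :
    ContinuousLinearMap.adjoint (τ.cornerEmbedding p hp hpM hp0)
      (τ.cornerEmbedding p hp hpM hp0 ξ) = ξ := by
  have : ContinuousLinearMap.adjoint (τ.cornerEmbedding p hp hpM hp0) ∘L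
      τ.cornerEmbedding p hp hpM hp0 = 1 := by
    refine ext_toL2 _ fun T => (τ.corner p hp hpM hp0).denseRange_toL2.eq_of_inner_right ℂ
      fun S => ?_
    rw [ContinuousLinearMap.comp_apply, ContinuousLinearMap.adjoint_inner_right,
      cornerEmbedding_toL2, cornerEmbedding_toL2]
    exact τ.inner_cornerToL2 p hp hpM hp0 S T
  exact congrArg (fun T : (τ.corner p hp hpM hp0).L2 →L[ℂ] (τ.corner p hp hpM hp0).L2 => T ξ) this

theorem cornerEmbedding_comp_adjoint (ξ : τ.L2) :
    τ.cornerEmbedding p hp hpM hp0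
      (ContinuousLinearMap.adjoint (τ.cornerEmbedding p hp hpM hp0) ξ) =
      τ.leftMul ⟨p, hpM⟩ (τ.rightMul ⟨p, hpM⟩ ξ) := by
  have : τ.cornerEmbedding p hp hpM hp0 ∘L
      ContinuousLinearMap.adjoint (τ.cornerEmbedding p hp hpM hp0) =
      τ.leftMul ⟨p, hpM⟩ ∘L τ.rightMul ⟨p, hpM⟩ := by
    refine ext_toL2 _ fun x => ?_
    have h0 := (τ.map_projection_pos p hp hpM hp0).ne'
    simp only [ContinuousLinearMap.comp_apply]
    rw [adjoint_cornerEmbedding_toL2, map_smul, cornerEmbedding_toL2, cornerInclusion_toCorner,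
      rightMul_toL2, leftMul_toL2, smul_smul, mul_right_comm, cornerScale_sq τ p hp hpM hp0,
      inv_mul_cancel₀ h0, one_smul, mul_assoc]
  exact congrArg (fun T : τ.L2 →L[ℂ] τ.L2 => T ξ) this

theorem leftMul_cornerEmbedding (T : M.corner p hp hpM) (ξ : (τ.corner p hp hpM hp0).L2) :
    τ.leftMul (M.cornerInclusion p hp hpM T) (τ.cornerEmbedding p hp hpM hp0 ξ) =
      τ.cornerEmbedding p hp hpM hp0 ((τ.corner p hp hpM hp0).leftMul T ξ) := by
  have : τ.leftMul (M.cornerInclusion p hp hpM T) ∘L τ.cornerEmbedding p hp hpM hp0 =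
      τ.cornerEmbedding p hp hpM hp0 ∘L (τ.corner p hp hpM hp0).leftMul T := by
    refine ext_toL2 _ fun S => ?_
    simp only [ContinuousLinearMap.comp_apply]
    rw [leftMul_toL2, cornerEmbedding_toL2, cornerEmbedding_toL2, map_smul, leftMul_toL2,
      cornerInclusion_mul]
  exact congrArg (fun T : (τ.corner p hp hpM hp0).L2 →L[ℂ] τ.L2 => T ξ) this

theorem leftMul_proj_cornerEmbedding (ξ : (τ.corner p hp hpM hp0).L2) :
    τ.leftMul ⟨p, hpM⟩ (τ.cornerEmbedding p hp hpM hp0 ξ) = τ.cornerEmbedding p hp hpM hp0 ξ := by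
  rw [← M.cornerInclusion_one p hp hpM, leftMul_cornerEmbedding, _root_.map_one]
  rfl

end Corner

end VonNeumannAlgebra.TraceState

/-! ### The crossed products and the isometry between their Hilbert spaces -/

namespace VonNeumannAlgebra

variable {H : Type u} [NormedAddCommGroup H] [InnerProductSpace ℂ H] [CompleteSpace H]
  {G : Type v} [Group G] {M : VonNeumannAlgebra H} (τ : M.TraceState)

section RightMultiplication

variable (α : CocycleAction G M)

/-- Pointwise right multiplication on `ℓ²(G, L²(M, τ))`. -/
def rightMulSpace (y : M) : α.Space τ →L[ℂ] α.Space τ :=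
  lpDiagonal (fun _ => τ.rightMul y) ‖τ.rightMul y‖ (norm_nonneg _) fun _ => le_rfl

theorem rightMulSpace_mul (x y : M) :
    rightMulSpace τ α (x * y) = rightMulSpace τ α y * rightMulSpace τ α x := by
  ext f g
  show τ.rightMul (x * y) (f g) = τ.rightMul y (τ.rightMul x (f g))
  rw [TraceState.rightMul_mul]
  rfl

theorem rightMulSpace_add (x y : M) :
    rightMulSpace τ α (x + y) = rightMulSpace τ α x + rightMulSpace τ α y := by
  ext f g
  show τ.rightMul (x + y) (f g) = τ.rightMul x (f g) + τ.rightMul y (f g)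
  rw [TraceState.rightMul_add]
  rfl

theorem rightMulSpace_one : rightMulSpace τ α 1 = 1 := by
  ext f g
  show τ.rightMul 1 (f g) = f g
  rw [TraceState.rightMul_one]
  rfl

theorem star_rightMulSpace (y : M) : star (rightMulSpace τ α y) = rightMulSpace τ α (star y) := by
  ext f g
  show ContinuousLinearMap.adjoint (rightMulSpace τ α y) f g = τ.rightMul (star y) (f g)
  rw [rightMulSpace, adjoint_lpDiagonal_apply, TraceState.adjoint_rightMul]

/-- `rightMulSpace` as an additive map. -/
def rightMulSpaceHom : M →+ (α.Space τ →L[ℂ] α.Space τ) :=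
  AddMonoidHom.mk' (rightMulSpace τ α) (rightMulSpace_add τ α)

/-- The generators permute `G` and act on the fibres by left multiplications, while the right
multiplication is the same on every fibre. -/
theorem rightMulSpace_mem_commutant (y : M) :
    rightMulSpace τ α y ∈ (α.crossedProduct τ).commutant := by
  have key : ∀ y, ∀ x ∈ Set.range (α.base τ) ∪ Set.range (α.implementing τ),
      x * rightMulSpace τ α y = rightMulSpace τ α y * x := by
    rintro y _ (⟨x, rfl⟩ | ⟨g, rfl⟩)
    · ext f h
      exact τ.leftMul_rightMul _ _ _
    · ext f h
      exact τ.leftMul_rightMul _ _ _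
  refine mem_commutant_generatedBy (key y) ?_
  rw [star_rightMulSpace]
  exact key _

end RightMultiplication

section CornerIsometry

variable {α : G →* (M ≃⋆ₐ[ℂ] M)} {p : H →L[ℂ] H} (hp : IsStarProjection p) {hpM : p ∈ M}
  (hp0 : p ≠ 0) {w : G → M} (hw : IsTransport α (⟨p, hpM⟩ : M) w)
include hw

/-- The bound must be uniform in `h`; it comes from `‖w_h‖² = ‖w_h w_h*‖ = ‖p‖`. -/
theorem norm_transport_le (h : G) :
    ‖τ.leftMul ((α h).symm (w h)) ∘L τ.cornerEmbedding p hp hpM hp0‖ ≤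
      √‖(⟨p, hpM⟩ : M)‖ * ‖τ.cornerEmbedding p hp hpM hp0‖ := by
  refine (ContinuousLinearMap.opNorm_comp_le _ _).trans ?_
  refine mul_le_mul_of_nonneg_right ?_ (norm_nonneg _)
  refine (CocycleAction.norm_leftMul_le τ (w h) (α h).symm).trans (Real.le_sqrt_of_sq_le ?_)
  rw [sq, ← CStarRing.norm_self_mul_star, hw.mul_star_self]

/-- The isometry `(J f)(h) = α_h⁻¹(w_h) f(h)` of `ℓ²(G, L²(pMp))` into `ℓ²(G, L²(M))`. -/
def cornerIsometry : (cornerCocycleAction hp hw).Space (τ.corner p hp hpM hp0) →L[ℂ]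
    (CocycleAction.ofAction α).Space τ :=
  lpDiagonal (fun h => τ.leftMul ((α h).symm (w h)) ∘L τ.cornerEmbedding p hp hpM hp0)
    (√‖(⟨p, hpM⟩ : M)‖ * ‖τ.cornerEmbedding p hp hpM hp0‖) (by positivity)
    (norm_transport_le τ hp hp0 hw)

theorem cornerIsometry_apply
    (f : (cornerCocycleAction hp hw).Space (τ.corner p hp hpM hp0)) (h : G) :
    cornerIsometry τ hp hp0 hw f h =
      τ.leftMul ((α h).symm (w h)) (τ.cornerEmbedding p hp hpM hp0 (f h)) := rfl

theorem adjoint_cornerIsometry_apply (f : (CocycleAction.ofAction α).Space τ) (h : G) :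
    ContinuousLinearMap.adjoint (cornerIsometry τ hp hp0 hw) f h =
      ContinuousLinearMap.adjoint (τ.cornerEmbedding p hp hpM hp0)
        (τ.leftMul ((α h).symm (star (w h))) (f h)) := by
  rw [cornerIsometry, adjoint_lpDiagonal_apply, ContinuousLinearMap.adjoint_comp,
    map_star, map_star]
  rfl

omit hw in
theorem leftMul_leftMul (x y : M) (ξ : τ.L2) :
    τ.leftMul x (τ.leftMul y ξ) = τ.leftMul (x * y) ξ := by
  rw [map_mul]; rfl

theorem adjoint_cornerIsometry_comp :
    ContinuousLinearMap.adjoint (cornerIsometry τ hp hp0 hw) ∘L cornerIsometry τ hp hp0 hw = 1 := by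
  ext f h
  rw [ContinuousLinearMap.comp_apply, adjoint_cornerIsometry_apply, cornerIsometry_apply,
    leftMul_leftMul, ← map_mul, hw.star_mul_self, StarAlgEquiv.symm_apply_apply,
    τ.leftMul_proj_cornerEmbedding, τ.adjoint_comp_cornerEmbedding]
  rfl

theorem cornerIsometry_comp_adjoint :
    cornerIsometry τ hp hp0 hw ∘L ContinuousLinearMap.adjoint (cornerIsometry τ hp hp0 hw) =
      (CocycleAction.ofAction α).base τ ⟨p, hpM⟩ *
        rightMulSpace τ (CocycleAction.ofAction α) ⟨p, hpM⟩ := by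
  ext f h
  show cornerIsometry τ hp hp0 hw (ContinuousLinearMap.adjoint (cornerIsometry τ hp hp0 hw) f) h =
    τ.leftMul ((α h).symm ⟨p, hpM⟩) (τ.rightMul ⟨p, hpM⟩ (f h))
  rw [cornerIsometry_apply, adjoint_cornerIsometry_apply,
    τ.cornerEmbedding_comp_adjoint, ← τ.leftMul_rightMul, leftMul_leftMul, leftMul_leftMul,
    hw.symm_conj_proj]

/-- The isometry intertwines the two copies of `pMp`. -/
theorem base_comp_cornerIsometry (T : M.corner p hp hpM) :
    (CocycleAction.ofAction α).base τ (M.cornerInclusion p hp hpM T) ∘L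
        cornerIsometry τ hp hp0 hw =
      cornerIsometry τ hp hp0 hw ∘L
        (cornerCocycleAction hp hw).base (τ.corner p hp hpM hp0) T := by
  ext f h
  show τ.leftMul ((α h).symm (M.cornerInclusion p hp hpM T))
      (τ.leftMul ((α h).symm (w h)) (τ.cornerEmbedding p hp hpM hp0 (f h))) =
    τ.leftMul ((α h).symm (w h)) (τ.cornerEmbedding p hp hpM hp0
      ((τ.corner p hp hpM hp0).leftMul ((cornerAct hp hw h).symm T) (f h)))
  rw [← τ.leftMul_cornerEmbedding, cornerInclusion_cornerAct_symm, leftMul_leftMul,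
    leftMul_leftMul, ← map_mul, ← map_mul, ← mul_assoc, ← mul_assoc, hw.mul_star_self,
    (mul_eq_of_corner hw.proj (M.corner_cornerInclusion p hp hpM T)).1]

/-- The isometry intertwines the operators implementing the two actions. -/
theorem implementing_comp_cornerIsometry (g : G) :
    ((CocycleAction.ofAction α).base τ (w g) * (CocycleAction.ofAction α).implementing τ g) ∘L
        cornerIsometry τ hp hp0 hw =
      cornerIsometry τ hp hp0 hw ∘L
        (cornerCocycleAction hp hw).implementing (τ.corner p hp hpM hp0) g := by
  ext f h
  show τ.leftMul ((α h).symm (w g)) (τ.leftMul ((α h).symm 1)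
      (τ.leftMul ((α (g⁻¹ * h)).symm (w (g⁻¹ * h)))
        (τ.cornerEmbedding p hp hpM hp0 (f (g⁻¹ * h))))) =
    τ.leftMul ((α h).symm (w h)) (τ.cornerEmbedding p hp hpM hp0
      ((τ.corner p hp hpM hp0).leftMul ((cornerAct hp hw h).symm
        (cornerCocycle hp hw g (g⁻¹ * h) : M.corner p hp hpM)) (f (g⁻¹ * h))))
  rw [← τ.leftMul_cornerEmbedding, cornerInclusion_cornerAct_symm, leftMul_leftMul,
    leftMul_leftMul, leftMul_leftMul, cornerInclusion_cornerCocycle, mul_assoc ((α h).symm (w g)),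
    hw.symm_cocycle]

omit hw in
theorem implementing_mul_base (g : G) (x : M) :
    (CocycleAction.ofAction α).implementing τ g * (CocycleAction.ofAction α).base τ x =
      (CocycleAction.ofAction α).base τ (α g x) * (CocycleAction.ofAction α).implementing τ g := by
  ext f h
  show τ.leftMul ((α h).symm 1) (τ.leftMul ((α (g⁻¹ * h)).symm x) (f (g⁻¹ * h))) =
    τ.leftMul ((α h).symm (α g x)) (τ.leftMul ((α h).symm 1) (f (g⁻¹ * h)))
  rw [leftMul_leftMul, leftMul_leftMul, IsTransport.symm_act_comm]

theorem compress_base (T : M.corner p hp hpM) :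
    compressBy (cornerIsometry τ hp hp0 hw)
        ((CocycleAction.ofAction α).base τ (M.cornerInclusion p hp hpM T)) =
      (cornerCocycleAction hp hw).base (τ.corner p hp hpM hp0) T :=
  compressBy_of_intertwine (adjoint_cornerIsometry_comp τ hp hp0 hw)
    (base_comp_cornerIsometry τ hp hp0 hw T)

/-- The extra factor from the corner is kept because the elements `a_i* u_g a_j` take exactly this
form. -/
theorem compress_implementing (T : M.corner p hp hpM) (g : G) :
    compressBy (cornerIsometry τ hp hp0 hw)
        ((CocycleAction.ofAction α).base τ (M.cornerInclusion p hp hpM T) *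
          ((CocycleAction.ofAction α).base τ (w g) *
            (CocycleAction.ofAction α).implementing τ g)) =
      (cornerCocycleAction hp hw).base (τ.corner p hp hpM hp0) T *
        (cornerCocycleAction hp hw).implementing (τ.corner p hp hpM hp0) g :=
  compressBy_of_intertwine (adjoint_cornerIsometry_comp τ hp hp0 hw)
    (intertwine_mul (base_comp_cornerIsometry τ hp hp0 hw T)
      (implementing_comp_cornerIsometry τ hp hp0 hw g))

/-- Right multiplication reverses products, so the family in the commutant is built from the
adjoints of the `r i`: then `b_i Q` is right multiplication by `p r_i* = r_i*`, and `b_i b_i*` is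
right multiplication by `r_i r_i*`. -/
theorem isReduction {ι : Type*} (s : Finset ι) (r : ι → M)
    (hr : ∀ i ∈ s, r i * ⟨p, hpM⟩ = r i) (hsum : ∑ i ∈ s, r i * star (r i) = 1) :
    IsReduction
      (Set.range ((CocycleAction.ofAction α).base τ) ∪
        Set.range ((CocycleAction.ofAction α).implementing τ))
      (Set.range ((cornerCocycleAction hp hw).base (τ.corner p hp hpM hp0)) ∪
        Set.range ((cornerCocycleAction hp hw).implementing (τ.corner p hp hpM hp0)))
      ((CocycleAction.ofAction α).base τ ⟨p, hpM⟩)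
      (rightMulSpace τ (CocycleAction.ofAction α) ⟨p, hpM⟩)
      (cornerIsometry τ hp hp0 hw) s (fun i => (CocycleAction.ofAction α).base τ (r i))
      (fun i => rightMulSpace τ (CocycleAction.ofAction α) (star (r i))) := by
  have hpr : ∀ i ∈ s, ⟨p, hpM⟩ * star (r i) = star (r i) := fun i hi => by
    have := congrArg star (hr i hi)
    rwa [star_mul, hw.proj.isSelfAdjoint.star_eq] at this
  have himp : ∀ g, (cornerCocycleAction hp hw).implementing (τ.corner p hp hpM hp0) g ∈
      generatedBy (Set.range ((cornerCocycleAction hp hw).base (τ.corner p hp hpM hp0)) ∪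
        Set.range ((cornerCocycleAction hp hw).implementing (τ.corner p hp hpM hp0))) :=
    fun g => subset_generatedBy _ (Or.inr ⟨g, rfl⟩)
  constructor
  · exact adjoint_cornerIsometry_comp τ hp hp0 hw
  · exact cornerIsometry_comp_adjoint τ hp hp0 hw
  · exact (CocycleAction.ofAction α).isStarProjection_base τ hp hpM
  · exact (CocycleAction.ofAction α).base_mem_crossedProduct τ _
  · refine ⟨?_, ?_⟩
    · rw [IsIdempotentElem, ← rightMulSpace_mul, hw.proj.isIdempotentElem]
    · rw [IsSelfAdjoint, star_rightMulSpace, hw.proj.isSelfAdjoint.star_eq]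
  · exact rightMulSpace_mem_commutant τ _ _
  · exact fun i _ => (CocycleAction.ofAction α).base_mem_crossedProduct τ _
  · intro i hi
    rw [← map_mul, hr i hi]
  · simp_rw [← map_star, ← map_mul, ← map_sum, hsum, map_one]
  · exact fun i _ => rightMulSpace_mem_commutant τ _ _
  · intro i hi
    rw [← rightMulSpace_mul, hpr i hi]
  · simp_rw [star_rightMulSpace, ← rightMulSpace_mul, star_star]
    rw [← rightMulSpace_one τ (CocycleAction.ofAction α), ← hsum]
    exact (map_sum (rightMulSpaceHom τ (CocycleAction.ofAction α)) _ _).symm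
  · rintro _ (⟨T, rfl⟩ | ⟨g, rfl⟩)
    · refine ⟨_, (CocycleAction.ofAction α).base_mem_crossedProduct τ _, ?_,
        compress_base τ hp hp0 hw T⟩
      rw [← map_mul, ← map_mul, corner_cornerInclusion]
    -- The implementing operator of the perturbed action lifts to `w_g u_g`, which is cut down by
    -- `P` on both sides since `p w_g = w_g` and `u_g p = α_g(p) u_g`.
    · refine ⟨(CocycleAction.ofAction α).base τ (w g) * (CocycleAction.ofAction α).implementing τ g,
        mul_mem ((CocycleAction.ofAction α).base_mem_crossedProduct τ _)
          (subset_generatedBy _ (Or.inr ⟨g, rfl⟩)), ?_, ?_⟩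
      · rw [← mul_assoc, ← map_mul, hw.proj_mul, mul_assoc, implementing_mul_base, ← mul_assoc,
          ← map_mul, hw.mul_proj]
      · have := compress_implementing τ hp hp0 hw 1 g
        rw [cornerInclusion_one, ← mul_assoc, ← map_mul, hw.proj_mul, map_one, one_mul] at this
        exact this
  · rintro i hi j hj _ (⟨x, rfl⟩ | ⟨g, rfl⟩)
    · obtain ⟨T, hT⟩ := M.exists_cornerInclusion_eq p hp hpM (x := star (r i) * x * r j) (by
        rw [← mul_assoc, ← mul_assoc, hpr i hi, mul_assoc, hr j hj])
      rw [← map_star, ← map_mul, ← map_mul, ← hT, compress_base τ hp hp0 hw]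
      exact (cornerCocycleAction hp hw).base_mem_crossedProduct _ T
    -- Since `r_j = r_j p`, one has `α_g(r_j) = α_g(r_j) w_g* w_g`. Hence `r_i* u_g r_j = (r_i*
    -- α_g(r_j) w_g*) (w_g u_g)`, with first factor in the corner.
    · obtain ⟨T, hT⟩ := M.exists_cornerInclusion_eq p hp hpM
        (x := star (r i) * α g (r j) * star (w g)) (by
        rw [← mul_assoc, ← mul_assoc, hpr i hi, mul_assoc (star (r i) * α g (r j)),
          hw.star_mul_proj])
      have h1 : star ((CocycleAction.ofAction α).base τ (r i)) *
          (CocycleAction.ofAction α).implementing τ g * (CocycleAction.ofAction α).base τ (r j) =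
          (CocycleAction.ofAction α).base τ (M.cornerInclusion p hp hpM T) *
            ((CocycleAction.ofAction α).base τ (w g) *
              (CocycleAction.ofAction α).implementing τ g) := by
        rw [hT, ← mul_assoc (_ : (CocycleAction.ofAction α).Space τ →L[ℂ] _), ← map_mul,
          mul_assoc _ (star (w g)), hw.star_mul_self, mul_assoc _ (α g (r j)), ← map_mul (α g),
          hr j hj, ← map_star, mul_assoc, implementing_mul_base, ← mul_assoc, ← map_mul]
      rw [h1, compress_implementing]
      exact mul_mem ((cornerCocycleAction hp hw).base_mem_crossedProduct _ T) (himp g)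
  · intro i hi
    obtain ⟨T, hT⟩ := M.exists_cornerInclusion_eq p hp hpM (x := ⟨p, hpM⟩ * r i) (by
      rw [← mul_assoc, hw.proj.isIdempotentElem, mul_assoc, hr i hi])
    rw [← map_mul, ← hT, compress_base τ hp hp0 hw]
    exact (cornerCocycleAction hp hw).base_mem_crossedProduct _ T

theorem isomorphicInclusions_corner {ι : Type*} (s : Finset ι) (r : ι → M)
    (hr : ∀ i ∈ s, r i * ⟨p, hpM⟩ = r i) (hsum : ∑ i ∈ s, r i * star (r i) = 1) :
    IsomorphicInclusions
        (((CocycleAction.ofAction α).baseAlgebra τ).corner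
          ((CocycleAction.ofAction α).base τ ⟨p, hpM⟩)
          ((CocycleAction.ofAction α).isStarProjection_base τ hp hpM)
          ((CocycleAction.ofAction α).base_mem_baseAlgebra τ ⟨p, hpM⟩))
        (((CocycleAction.ofAction α).crossedProduct τ).corner
          ((CocycleAction.ofAction α).base τ ⟨p, hpM⟩)
          ((CocycleAction.ofAction α).isStarProjection_base τ hp hpM)
          ((CocycleAction.ofAction α).base_mem_crossedProduct τ ⟨p, hpM⟩))
        ((cornerCocycleAction hp hw).baseAlgebra (τ.corner p hp hpM hp0))
        ((cornerCocycleAction hp hw).crossedProduct (τ.corner p hp hpM hp0)) := by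
  refine (isReduction τ hp hp0 hw s r hr hsum).isomorphicInclusions
    ((CocycleAction.ofAction α).base_mem_baseAlgebra τ ⟨p, hpM⟩) ?_ ?_ ?_ ?_
  · rintro _ ⟨x, rfl⟩
    exact (CocycleAction.ofAction α).base_mem_crossedProduct τ x
  · rintro _ ⟨x, rfl⟩
    exact (cornerCocycleAction hp hw).base_mem_crossedProduct _ x
  · rintro _ ⟨x, rfl⟩
    obtain ⟨T, hT⟩ := M.exists_cornerInclusion_eq p hp hpM (x := ⟨p, hpM⟩ * x * ⟨p, hpM⟩) (by
      rw [← mul_assoc, ← mul_assoc, hw.proj.isIdempotentElem, mul_assoc,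
        hw.proj.isIdempotentElem])
    refine ⟨T, ?_⟩
    refine (compress_base τ hp hp0 hw T).symm.trans (congrArg _ ?_)
    rw [hT, map_mul, map_mul]
    rfl
  · rintro _ ⟨T, rfl⟩
    refine ⟨_, (CocycleAction.ofAction α).base_mem_baseAlgebra τ (M.cornerInclusion p hp hpM T),
      ?_, compress_base τ hp hp0 hw T⟩
    rw [← map_mul, ← map_mul, corner_cornerInclusion]

end CornerIsometry

end VonNeumannAlgebra

end

/-! ### Assembly of the theorem -/

theorem lemma1p9 {H : Type*} [NormedAddCommGroup H] [InnerProductSpace ℂ H] [CompleteSpace H]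
    {G : Type*} [Group G] (M : VonNeumannAlgebra H) (hM : M.IsIIOneFactor) (τ : M.TraceState)
    (α : G →* (M ≃⋆ₐ[ℂ] M)) (p : H →L[ℂ] H) (hp : IsStarProjection p) (hpM : p ∈ M)
    (hp0 : p ≠ 0) :
    ∃ β : CocycleAction G (M.corner p hp hpM),
      ((CocycleAction.ofAction α).IsProperlyOuter → β.IsProperlyOuter) ∧
      IsomorphicInclusions
        (((CocycleAction.ofAction α).baseAlgebra τ).corner
          ((CocycleAction.ofAction α).base τ ⟨p, hpM⟩)
          ((CocycleAction.ofAction α).isStarProjection_base τ hp hpM)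
          ((CocycleAction.ofAction α).base_mem_baseAlgebra τ ⟨p, hpM⟩))
        (((CocycleAction.ofAction α).crossedProduct τ).corner
          ((CocycleAction.ofAction α).base τ ⟨p, hpM⟩)
          ((CocycleAction.ofAction α).isStarProjection_base τ hp hpM)
          ((CocycleAction.ofAction α).base_mem_crossedProduct τ ⟨p, hpM⟩))
        (β.baseAlgebra (τ.corner p hp hpM hp0))
        (β.crossedProduct (τ.corner p hp hpM hp0)) := by
  have hA := hM.isFactor.hasComparison
  have ht := τ.isFaithfulTrace_re
  have hP := M.isStarProjection_mk p hp hpM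
  obtain ⟨w, hw⟩ := ht.exists_isTransport hA α hP
  -- Dividing `1` by `p` gives `n + 1` elements `r i = r i * p` with `∑ r_i r_i* = 1`; the shape of
  -- the remainder plays no role here.
  obtain ⟨n, r, hsum, hr, -, -⟩ := ht.exists_division hA hP
    (fun h => hp0 (congrArg Subtype.val h)) (p := 1) (.one M)
  exact ⟨VonNeumannAlgebra.cornerCocycleAction hp hw,
    VonNeumannAlgebra.cornerCocycleAction_isProperlyOuter hp hw _ r (fun i _ => hr i) hsum,
    VonNeumannAlgebra.isomorphicInclusions_corner τ hp hp0 hw _ r (fun i _ => hr i) hsum⟩
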